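/- Let $N\ge 0$, let $m_j,n_j>0$ ($1\le j\le N$) and $x_1<x_2<\dots<x_N$ be real numbers, and put $h_j=m_je^{x_j}$, $g_j=n_je^{-x_j}$, $h=\sum_j h_j\delta_{x_j}$, $g=\sum_j g_j\delta_{x_j}$ and $k'=N-k+1$. For $z\in\mathbb C$ consider the distributional system $$\Phi_x=\begin{bmatrix}0&h\\-zg&0\end{bmatrix}\Phi ,\qquad \Phi=(\Phi_1,\Phi_2)\ \text{left continuous and locally integrable},\qquad \Phi_a\delta_{x_j}:=\Phi_a(x_j)\delta_{x_j}.$$ For every $z$ it has exactly one solution $\Phi(\cdot;z)$ with $\Phi_1(-\infty)=0$, $\Phi_2(-\infty)=1$. A number $z$ is called an eigenvalue if there is a nonzero solution with $\Phi_1(-\infty)=\Phi_2(+\infty)=0$. There are unique spectral data $\{d\mu,c\}$, $d\mu=\sum_{j=1}^{K}b_j\delta_{\zeta_j}$, $K=\lfloor N/2\rfloor$, $0<\zeta_1<\dots<\zeta_K$, $b_j>0$, with $c>0$ if $N$ is odd and $c=0$ if $N$ is even, such that $\{\zeta_1,\dots,\zeta_K\}$ is the set of eigenvalues and, for every $z$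 that is not an eigenvalue, the Weyl function is $$W(z)=\frac{\Phi_1(+\infty;z)}{\Phi_2(+\infty;z)}=c+\int\frac{d\mu(s)}{s-z}.$$ Put $e_j=\frac1{m_{j'}n_{j'}}$, $\mathbf e_{[1,j]}=e_1\cdots e_j$, $\hat\mu_c(y)=c+\int\frac{d\mu(s)}{y+s}$. For integers $l,p\ge0$ with $l\le k$, $p+l-1\le k-l$, let $\mathcal D_k^{(l,p)}$ be the absolute value of the determinant of the $k\times k$ Cauchy–Stieltjes–Vandermonde (CSV) matrix whose $i$-th row is $$\big(e_i^{p}\hat\mu_c(e_i),\,e_i^{p+1}\hat\mu_c(e_i),\dots,e_i^{p+l-1}\hat\mu_c(e_i),\,1,\,e_i,\dots,e_i^{k-l-1}\big),$$ with $\mathcal D_0^{(l,p)}=1$. (1) If the products $m_jn_j$ are distinct, then for $1\le k\le N$ all determinants $\mathcal D$ in the following formulas are positive, and the positions are $$x_{k'}=\ln\frac{\mathbf e_{[1,k-1]}\,\mathcal D_k^{(\frac{k+1}2,0)}\,\mathcal D_{k-1}^{(\frac{k-1}2,0)}}{m_{k'}\,\mathcal D_k^{(\frac{k-1}2,1)}\,\mathcal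 D_{k-1}^{(\frac{k-1}2,1)}}\quad(k\text{ odd}),\qquad x_{k'}=\ln\frac{\mathbf e_{[1,k-1]}\,\mathcal D_k^{(\frac k2,0)}\,\mathcal D_{k-1}^{(\frac k2,0)}}{m_{k'}\,\mathcal D_k^{(\frac k2,1)}\,\mathcal D_{k-1}^{(\frac k2-1,1)}}\quad(k\text{ even}).$$ (2) Without assuming the products distinct, for all $0\le k\le N$ and all $l,p$ as above, $$\mathcal D_k^{(l,p)}=\prod_{1\le i<j\le k}|e_j-e_i|\;\widetilde{\mathcal D}_k^{(l,p)},\qquad \widetilde{\mathcal D}_k^{(l,p)}=\Sigma_k^{(l,p)}+\begin{cases}c\,\Sigma_k^{(l-1,p)},&l\ge1,\ p+l-1=k-l,\\0,&\text{otherwise},\end{cases}$$ $$\Sigma_k^{(l,p)}=\sum_{I\subseteq\{1,\dots,K\},\,|I|=l}\ \frac{\prod_{i<j,\ i,j\in I}(\zeta_j-\zeta_i)^2\ \prod_{i\in I}b_i\zeta_i^{p}}{\prod_{r=1}^{k}\prod_{i\in I}(e_r+\zeta_i)},$$ and the formulas of (1) hold with every $\mathcal D$ replaced by $\widetilde{\mathcal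 D}$ (each $\widetilde{\mathcal D}$ in them being positive). -/

import Mathlib

open MeasureTheory Filter Topology
open scoped ContDiff

noncomputable section

/-! Conventions: peakon indices are `1, …, N`, so `m, n, x : ℕ → ℝ` are only ever read on
`[1, N]`; the reflected index `k' = N - k + 1` is written `N + 1 - k`. -/

/-- The weight `h_j = m_j e^{x_j}` of the discrete measure `h = ∑ h_j δ_{x_j}`. -/
def hWeight (m x : ℕ → ℝ) (j : ℕ) : ℝ := m j * Real.exp (x j)

/-- The weight `g_j = n_j e^{-x_j}` of the discrete measure `g = ∑ g_j δ_{x_j}`. -/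
def gWeight (n x : ℕ → ℝ) (j : ℕ) : ℝ := n j * Real.exp (-x j)

/-- `Φ = (Φ₁, Φ₂)` solves the distributional system `Φ₁' = h Φ₂`, `Φ₂' = -z g Φ₁` on `ℝ`, where
`h = ∑ h_j δ_{x_j}`, `g = ∑ g_j δ_{x_j}`, the function `Φ` is left continuous, and the products
of `Φ` with the measures are given by `Φ_a δ_{x_j} = Φ_a(x_j) δ_{x_j}`. -/
structure SolvesSystem (N : ℕ) (m n x : ℕ → ℝ) (z : ℂ) (Φ : ℝ → ℂ × ℂ) : Prop where
  leftContinuous : ∀ y : ℝ, ContinuousWithinAt Φ (Set.Iic y) y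
  locallyIntegrable : LocallyIntegrable Φ volume
  eq_fst : ∀ φ : ℝ → ℝ, ContDiff ℝ ∞ φ → HasCompactSupport φ →
    -∫ y, ((deriv φ y : ℝ) : ℂ) * (Φ y).1
      = ∑ j ∈ Finset.Icc 1 N, (hWeight m x j : ℂ) * (Φ (x j)).2 * (φ (x j) : ℂ)
  eq_snd : ∀ φ : ℝ → ℝ, ContDiff ℝ ∞ φ → HasCompactSupport φ →
    -∫ y, ((deriv φ y : ℝ) : ℂ) * (Φ y).2
      = ∑ j ∈ Finset.Icc 1 N, -z * (gWeight n x j : ℂ) * (Φ (x j)).1 * (φ (x j) : ℂ)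

/-- The solution normalized at `-∞` by `Φ₁(-∞) = 0`, `Φ₂(-∞) = 1`. -/
def IsNormalizedSolution (N : ℕ) (m n x : ℕ → ℝ) (z : ℂ) (Φ : ℝ → ℂ × ℂ) : Prop :=
  SolvesSystem N m n x z Φ ∧ Tendsto Φ atBot (𝓝 (0, 1))

/-- `z` is an eigenvalue of the boundary value problem `Φ₁(-∞) = 0 = Φ₂(+∞)`. -/
def IsEigenvalueBVP (N : ℕ) (m n x : ℕ → ℝ) (z : ℂ) : Prop :=
  ∃ Φ : ℝ → ℂ × ℂ, SolvesSystem N m n x z Φ ∧ Φ ≠ 0 ∧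
    Tendsto (fun y => (Φ y).1) atBot (𝓝 0) ∧ Tendsto (fun y => (Φ y).2) atTop (𝓝 0)

/-- Candidate spectral data: nodes `ζ_1, …, ζ_K`, weights `b_1, …, b_K` and a shift `c`. -/
@[ext] structure SpectralData (K : ℕ) where
  ζ : Fin K → ℝ
  b : Fin K → ℝ
  c : ℝ

/-- The discrete measure `dμ = ∑ b_j δ_{ζ_j}`. -/
def SpectralData.measure {K : ℕ} (S : SpectralData K) : Measure ℝ :=
  ∑ j, ENNReal.ofReal (S.b j) • Measure.dirac (S.ζ j)

/-- `S = {dμ, c}` is the spectral data of the boundary value problem, `Φ z` being the normalized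
solution with spectral parameter `z`: the nodes `0 < ζ_1 < ⋯ < ζ_{⌊N/2⌋}` make up the spectrum,
the weights are positive, `c > 0` for odd `N` and `c = 0` for even `N`, and the Weyl function
`W(z) = Φ₁(+∞; z) / Φ₂(+∞; z)` is `c + ∫ dμ(s) / (s - z)`. -/
structure IsSpectralData (N : ℕ) (m n x : ℕ → ℝ) (Φ : ℂ → ℝ → ℂ × ℂ)
    (S : SpectralData (N / 2)) : Prop where
  node_pos : ∀ j, 0 < S.ζ j
  node_strictMono : StrictMono S.ζ
  weight_pos : ∀ j, 0 < S.b j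
  shift_pos_of_odd : Odd N → 0 < S.c
  shift_eq_zero_of_even : Even N → S.c = 0
  spectrum_eq : ∀ z : ℂ, IsEigenvalueBVP N m n x z ↔ ∃ j, z = (S.ζ j : ℂ)
  weyl_eq : ∀ z : ℂ, ¬ IsEigenvalueBVP N m n x z →
    ∃ q p : ℂ, Tendsto (Φ z) atTop (𝓝 (q, p)) ∧ p ≠ 0 ∧
      q / p = (S.c : ℂ) + ∫ s, 1 / ((s : ℂ) - z) ∂S.measure

/-- The shifted Stieltjes transform `c + ∫ dν(s) / (y + s)`. -/
def stieltjesTransform (ν : Measure ℝ) (c y : ℝ) : ℝ := c + ∫ s, 1 / (y + s) ∂ν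

/-- The Cauchy-Stieltjes-Vandermonde matrix `CSV_k^{(l,p)}(e, ν, c)`: its first `l` columns are
`e_i^p ν̂_c(e_i), …, e_i^{p+l-1} ν̂_c(e_i)`, the other ones `1, e_i, …, e_i^{k-l-1}`. -/
def CSV (k l p : ℕ) (e : Fin k → ℝ) (ν : Measure ℝ) (c : ℝ) : Matrix (Fin k) (Fin k) ℝ :=
  Matrix.of fun i j =>
    if (j : ℕ) < l then e i ^ (p + (j : ℕ)) * stieltjesTransform ν c (e i)
    else e i ^ ((j : ℕ) - l)

/-- `e_j = 1 / (m_{j'} n_{j'})`, where `j' = N - j + 1`. -/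
def eCoord (N : ℕ) (m n : ℕ → ℝ) (j : ℕ) : ℝ := 1 / (m (N + 1 - j) * n (N + 1 - j))

/-- `𝒟_k^{(l,p)} = |det CSV_k^{(l,p)}(e, μ, c)|`, with the first `k` entries of `e`
(it equals `1` for `k = 0`). -/
def csvD {K : ℕ} (e : ℕ → ℝ) (S : SpectralData K) (k l p : ℕ) : ℝ :=
  |(CSV k l p (fun i : Fin k => e ((i : ℕ) + 1)) S.measure S.c).det|

/-- The Vandermonde product `Δ_{[1,k]}(e) = ∏_{1 ≤ i < j ≤ k} (e_j - e_i)`. -/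
def vandermondeE (e : ℕ → ℝ) (k : ℕ) : ℝ :=
  ∏ i ∈ Finset.Icc 1 k, ∏ j ∈ Finset.Ioc i k, (e j - e i)

/-- `∑_{|I| = l} Δ_I(ζ)² b_I ζ_I^p / Γ_{[1,k],I}(e; ζ)`, that is, the integral over
`s_1 < ⋯ < s_l` of `Δ(s)² / ∏_{i,r} (e_i + s_r)` against `s_1^p dμ(s_1) ⋯ s_l^p dμ(s_l)`. -/
def csvSum {K : ℕ} (e : ℕ → ℝ) (S : SpectralData K) (k l p : ℕ) : ℝ :=
  ∑ I ∈ Finset.powersetCard l (Finset.univ : Finset (Fin K)),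
    (∏ i ∈ I, ∏ j ∈ I with i < j, (S.ζ j - S.ζ i)) ^ 2 * (∏ i ∈ I, S.b i * S.ζ i ^ p) /
      ∏ r ∈ Finset.Icc 1 k, ∏ i ∈ I, (e r + S.ζ i)

/-- What remains of `𝒟_k^{(l,p)}` when the factor `|Δ_{[1,k]}(e)|` is removed. The term with `c`
occurs only for `p + l - 1 = k - l`, and not for `l = 0`. -/
def csvReduced {K : ℕ} (e : ℕ → ℝ) (S : SpectralData K) (k l p : ℕ) : ℝ :=
  csvSum e S k l p + if 1 ≤ l ∧ p + 2 * l = k + 1 then S.c * csvSum e S k (l - 1) p else 0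

/-- The formulas for the positions `x_{k'}`, `1 ≤ k ≤ N`, in terms of a family `D k l p`
(to be read `D_k^{(l,p)}`), together with the positivity that makes them meaningful. -/
def PositionFormulas (N : ℕ) (m x e : ℕ → ℝ) (D : ℕ → ℕ → ℕ → ℝ) : Prop :=
  ∀ k : ℕ, 1 ≤ k → k ≤ N →
    (Odd k →
      0 < D k ((k + 1) / 2) 0 ∧ 0 < D (k - 1) ((k - 1) / 2) 0 ∧
      0 < D k ((k - 1) / 2) 1 ∧ 0 < D (k - 1) ((k - 1) / 2) 1 ∧
      x (N + 1 - k) = Real.log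
        (((∏ j ∈ Finset.Icc 1 (k - 1), e j) * D k ((k + 1) / 2) 0 * D (k - 1) ((k - 1) / 2) 0) /
          (m (N + 1 - k) * D k ((k - 1) / 2) 1 * D (k - 1) ((k - 1) / 2) 1))) ∧
    (Even k →
      0 < D k (k / 2) 0 ∧ 0 < D (k - 1) (k / 2) 0 ∧
      0 < D k (k / 2) 1 ∧ 0 < D (k - 1) (k / 2 - 1) 1 ∧
      x (N + 1 - k) = Real.log
        (((∏ j ∈ Finset.Icc 1 (k - 1), e j) * D k (k / 2) 0 * D (k - 1) (k / 2) 0) /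
          (m (N + 1 - k) * D k (k / 2) 1 * D (k - 1) (k / 2 - 1) 1)))

end

/-! A left continuous solution of the system is a step function with jumps at the `x_j`. Its values
are transported by the matrices `[[1, h_j], [-z g_j, 1]]`, because by left continuity the value at
`x_j` is the one before the jump. The solution with value `(0, 1)` at `-∞` therefore ends at `(Q(z),
P(z))` with polynomials `Q`, `P`, the eigenvalues are the zeros of `P`, and `W = Q / P`
(`isNormalizedSolution_iff`, `isEigenvalueBVP_iff`).

Adding one mass point preserves the interlacing of the positive zeros of `P` with the signs of `Q`
(`Interlacing.step`). This makes the zeros simple and positive and the residue weights positive.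
Partial fractions then give existence and uniqueness of the spectral data
(`Interlacing.exists_represents`, `isSpectralData_iff_represents`).

For the inverse problem, multiply `(Q, P)` by the adjugates of the last `k` transfer matrices. The
result is `(Q, P)` for the first `N - k` points, times the determinant `∏ (1 + z / e_i)`. In each
row this has the form `F Q + G P = E R` with `E = ∏ (X + e_i)`, so that `F W + G` vanishes at the
points `-e_i`. The sum of all residues of `(F W + G) / E` is zero, which is a linear relation
between the coefficients of `F` and the moments `M_r = ∑ b_j ζ_j^r / E(ζ_j)`, with `c` added to
`M_{k-1}` as contribution of infinity (`sum_residues_eq_neg_coeff`). The degree bounds turn these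
relations into small Hankel systems. Cramer's rule gives leading coefficients as ratios of Hankel
determinants, and `h_{k'}` is a quotient of leading coefficients of consecutive steps
(`weight_mul_hankelDet_even`, `weight_mul_hankelDet_odd`). Divisibility by `E` replaces
interpolation at the `-e_i`, so coinciding `e_i` cause no trouble.

It remains to compare determinants. The Heine formula identifies the Hankel determinants with the
sums over subsets, the `c` term coming from the corner entry (`csvReduced_eq_hankelDet`). Divided
differences at `e_1, …, e_k` turn the CSV matrix into a block triangular one with a Hankel block, up
to signs, at the cost of the Vandermonde factor (`abs_det_CSV_eq`). That factor cancels in the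
position formulas (`PositionFormulas.of_mul`). -/

/-! ### Distributional solutions are step functions. -/

/-- A smooth compactly supported function with vanishing integral is the derivative of a smooth
compactly supported function. -/
lemma exists_deriv_eq_of_integral_eq_zero {θ : ℝ → ℝ} (hθ : ContDiff ℝ ∞ θ)
    (hc : HasCompactSupport θ) (h0 : ∫ y, θ y = 0) :
    ∃ Θ : ℝ → ℝ, ContDiff ℝ ∞ Θ ∧ HasCompactSupport Θ ∧ deriv Θ = θ := by
  obtain ⟨R, hR⟩ := hc.isCompact.isBounded.subset_closedBall 0
  have hz : ∀ y, y ∉ Set.Icc (-R) R → θ y = 0 := by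
    intro y hy
    by_contra hne
    apply hy
    have := hR (subset_tsupport _ hne)
    rwa [Real.closedBall_eq_Icc, zero_sub, zero_add] at this
  have hcont := hθ.continuous
  -- The primitive starts to the left of the support; to the right of it it equals the total
  -- integral, which is zero.
  have hd : ∀ y, HasDerivAt (fun y => ∫ t in (-R)..y, θ t) (θ y) y := fun y =>
    intervalIntegral.integral_hasDerivAt_right (hcont.intervalIntegrable _ _)
      hcont.stronglyMeasurable.stronglyMeasurableAtFilter hcont.continuousAt
  have hde : deriv (fun y => ∫ t in (-R)..y, θ t) = θ := funext fun y => (hd y).deriv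
  refine ⟨fun y => ∫ t in (-R)..y, θ t, ?_, ?_, hde⟩
  · rw [contDiff_infty_iff_deriv]
    exact ⟨fun y => (hd y).differentiableAt, by rwa [hde]⟩
  · apply HasCompactSupport.of_support_subset_isCompact (isCompact_Icc (a := -R) (b := R))
    intro y hy
    by_contra hyn
    apply hy
    rw [Set.mem_Icc, not_and_or, not_le, not_le] at hyn
    show ∫ t in (-R)..y, θ t = 0
    rcases hyn with hlt | hlt
    · rw [intervalIntegral.integral_of_ge hlt.le, neg_eq_zero,
        ← integral_Icc_eq_integral_Ioc, integral_Icc_eq_integral_Ico]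
      refine setIntegral_eq_zero_of_forall_eq_zero fun t ht => hz t fun h => ?_
      exact absurd h.1 (not_le.2 ht.2)
    · by_cases hRR : -R ≤ y
      · rw [intervalIntegral.integral_of_le hRR, ← integral_Icc_eq_integral_Ioc, ← h0]
        refine setIntegral_eq_integral_of_forall_compl_eq_zero fun t ht => hz t fun h => ?_
        exact ht ⟨h.1, h.2.trans hlt.le⟩
      · rw [intervalIntegral.integral_of_ge (not_le.1 hRR).le, neg_eq_zero]
        refine setIntegral_eq_zero_of_forall_eq_zero fun t ht => hz t fun h => ?_
        exact absurd h.2 (not_le.2 (hlt.trans ht.1))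

lemma integrable_smul_of_hasCompactSupport {w : ℝ → ℂ} (hw : LocallyIntegrable w volume)
    {φ : ℝ → ℝ} (hφ : Continuous φ) (hc : HasCompactSupport φ) :
    Integrable (fun y => (φ y : ℂ) * w y) volume := by
  have := hw.integrable_smul_left_of_hasCompactSupport hφ hc
  simpa [Complex.real_smul] using this

/-- The lemma of du Bois-Reymond. -/
lemma ae_eq_const_of_integral_deriv_mul_eq_zero {w : ℝ → ℂ} (hw : LocallyIntegrable w volume)
    (h : ∀ φ : ℝ → ℝ, ContDiff ℝ ∞ φ → HasCompactSupport φ →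
      ∫ y, ((deriv φ y : ℝ) : ℂ) * w y = 0) :
    ∃ C : ℂ, ∀ᵐ y, w y = C := by
  let B : ContDiffBump (0 : ℝ) := ⟨1, 2, one_pos, one_lt_two⟩
  set ρ : ℝ → ℝ := B.normed volume with hρ
  have hρs : ContDiff ℝ ∞ ρ := B.contDiff_normed
  have hρc : HasCompactSupport ρ := B.hasCompactSupport_normed
  have hρi : ∫ y, ρ y = 1 := B.integral_normed
  set C : ℂ := ∫ y, (ρ y : ℂ) * w y with hC
  refine ⟨C, ?_⟩
  have hloc : LocallyIntegrable (fun y => w y - C) volume := hw.sub (locallyIntegrable_const C)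
  have key := ae_eq_zero_of_integral_contDiff_smul_eq_zero hloc ?_
  · filter_upwards [key] with y hy using sub_eq_zero.1 hy
  intro ψ hψ hψc
  set I : ℝ := ∫ y, ψ y with hI
  have hψint : Integrable ψ volume := hψ.continuous.integrable_of_hasCompactSupport hψc
  have hρint : Integrable ρ volume := hρs.continuous.integrable_of_hasCompactSupport hρc
  -- Subtracting the multiple of the unit-mass bump `ρ` with the same integral makes the test
  -- function a derivative, to which the hypothesis applies.
  obtain ⟨Θ, h1, h2, h3⟩ := exists_deriv_eq_of_integral_eq_zero (θ := fun y => ψ y - I * ρ y)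
    (hψ.sub (contDiff_const.mul hρs)) (hψc.sub hρc.mul_left) (by
      rw [integral_sub hψint (hρint.const_mul I), integral_const_mul, hρi, mul_one, sub_self])
  have h4 := h Θ h1 h2
  rw [h3] at h4
  have i1 := integrable_smul_of_hasCompactSupport hw hψ.continuous hψc
  have i2 := integrable_smul_of_hasCompactSupport hw hρs.continuous hρc
  have e1 : ∫ y, ((ψ y - I * ρ y : ℝ) : ℂ) * w y
      = (∫ y, (ψ y : ℂ) * w y) - I * C := by
    rw [hC, ← integral_const_mul, ← integral_sub i1 (i2.const_mul _)]
    congr 1; ext y; push_cast; ring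
  have e2 : ∫ y, ψ y • (w y - C) = (∫ y, (ψ y : ℂ) * w y) - I * C := by
    have : (I : ℂ) = ∫ y, (ψ y : ℂ) := by rw [hI]; exact integral_ofReal.symm
    have i3 : Integrable (fun y => (ψ y : ℂ)) volume := hψint.ofReal
    rw [this, ← integral_mul_const, ← integral_sub i1 (i3.mul_const _)]
    congr 1; ext y; rw [Complex.real_smul]; ring
  rw [e2, ← e1, h4]

/-- If `w y ≠ C`, left continuity gives a whole interval `(l, y]` on which `w ≠ C`, and this has
positive measure. -/
lemma eq_const_of_leftContinuous_of_ae_eq {w : ℝ → ℂ}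
    (hl : ∀ y, ContinuousWithinAt w (Set.Iic y) y) {C : ℂ} (h : ∀ᵐ y, w y = C) (y : ℝ) :
    w y = C := by
  by_contra hne
  have hev : ∀ᶠ t in 𝓝[≤] y, w t ≠ C := (hl y).eventually_ne hne
  obtain ⟨l, hly, hsub⟩ := (mem_nhdsLE_iff_exists_Ioc_subset).1 hev
  have h0 : volume (Set.Ioc l y) = 0 := measure_mono_null hsub (ae_iff.1 h)
  rw [Real.volume_Ioc, ENNReal.ofReal_eq_zero] at h0
  have : l < y := hly
  linarith

lemma integral_deriv_mul_step {φ : ℝ → ℝ} (hφ : ContDiff ℝ ∞ φ) (hc : HasCompactSupport φ)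
    (a : ℝ) (c : ℂ) :
    ∫ y, ((deriv φ y : ℝ) : ℂ) * (if a < y then c else 0) = -(c * (φ a : ℂ)) := by
  have e : (fun y => ((deriv φ y : ℝ) : ℂ) * (if a < y then c else 0))
      = Set.indicator (Set.Ioi a) (fun y => ((deriv φ y : ℝ) : ℂ) * c) := by
    ext y
    by_cases hy : a < y
    · simp [hy]
    · simp [hy]
  rw [e, integral_indicator measurableSet_Ioi, integral_mul_const, integral_complex_ofReal,
    hc.integral_Ioi_deriv_eq (hφ.of_le (by exact_mod_cast le_top)) a]
  push_cast; ring

/-- The step function `C + ∑ a_j 1_{y > x_j}`. -/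
noncomputable def stepSum (s : Finset ℕ) (x : ℕ → ℝ) (a : ℕ → ℂ) (y : ℝ) : ℂ :=
  ∑ j ∈ s, if x j < y then a j else 0

lemma step_leftContinuous (a : ℝ) (c : ℂ) (y : ℝ) :
    ContinuousWithinAt (fun t => if a < t then c else 0) (Set.Iic y) y := by
  by_cases h : a < y
  · have : (fun t => if a < t then c else 0) =ᶠ[𝓝[≤] y] fun _ => c := by
      filter_upwards [nhdsWithin_le_nhds (lt_mem_nhds h)] with t ht
      simp [ht]
    exact continuousWithinAt_const.congr_of_eventuallyEq this (by simp [h])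
  · have : (fun t => if a < t then c else 0) =ᶠ[𝓝[≤] y] fun _ => 0 := by
      filter_upwards [self_mem_nhdsWithin] with t ht
      have : ¬ a < t := fun h' => h (h'.trans_le ht)
      simp [this]
    exact continuousWithinAt_const.congr_of_eventuallyEq this (by simp [h])

lemma stepSum_leftContinuous (s : Finset ℕ) (x : ℕ → ℝ) (a : ℕ → ℂ) (y : ℝ) :
    ContinuousWithinAt (stepSum s x a) (Set.Iic y) y := by
  have : stepSum s x a = fun t => ∑ j ∈ s, if x j < t then a j else 0 := rfl
  rw [this]
  exact tendsto_finsetSum _ fun j _ => step_leftContinuous _ _ _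

lemma step_locallyIntegrable (a : ℝ) (c : ℂ) :
    LocallyIntegrable (fun t => if a < t then c else 0) volume := by
  have : (fun t => if a < t then c else 0) = Set.indicator (Set.Ioi a) (fun _ => c) := by
    ext t; by_cases h : a < t <;> simp [h]
  rw [this]
  exact (locallyIntegrable_const c).indicator measurableSet_Ioi

lemma stepSum_locallyIntegrable (s : Finset ℕ) (x : ℕ → ℝ) (a : ℕ → ℂ) :
    LocallyIntegrable (stepSum s x a) volume := by
  have : stepSum s x a = ∑ j ∈ s, fun t => if x j < t then a j else 0 := by
    ext t; simp [stepSum]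
  rw [this]
  exact locallyIntegrable_finsetSum' _ fun j _ => step_locallyIntegrable _ _

lemma integral_deriv_mul_stepSum {φ : ℝ → ℝ} (hφ : ContDiff ℝ ∞ φ) (hc : HasCompactSupport φ)
    (s : Finset ℕ) (x : ℕ → ℝ) (a : ℕ → ℂ) :
    ∫ y, ((deriv φ y : ℝ) : ℂ) * stepSum s x a y = -∑ j ∈ s, a j * (φ (x j) : ℂ) := by
  simp only [stepSum, Finset.mul_sum]
  rw [integral_finsetSum, ← Finset.sum_neg_distrib]
  · exact Finset.sum_congr rfl fun j _ => integral_deriv_mul_step hφ hc _ _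
  · intro j _
    exact integrable_smul_of_hasCompactSupport (step_locallyIntegrable _ _)
      (hφ.continuous_deriv (by exact_mod_cast le_top)) hc.deriv

lemma integral_deriv_mul_const {φ : ℝ → ℝ} (hφ : ContDiff ℝ ∞ φ) (hc : HasCompactSupport φ)
    (C : ℂ) : ∫ y, ((deriv φ y : ℝ) : ℂ) * C = 0 := by
  rw [integral_mul_const, integral_complex_ofReal, integral_eq_zero_of_hasDerivAt_of_integrable
    (f := φ), Complex.ofReal_zero, zero_mul]
  · exact fun y => (hφ.differentiable (by simp) y).hasDerivAt
  · exact (hφ.continuous_deriv (by exact_mod_cast le_top)).integrable_of_hasCompactSupport hc.deriv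
  · exact hφ.continuous.integrable_of_hasCompactSupport hc

/-- The left continuous solutions of `u' = ∑ a_j δ_{x_j}` are the step functions. -/
lemma eq_const_add_stepSum {u : ℝ → ℂ} (s : Finset ℕ) (x : ℕ → ℝ) (a : ℕ → ℂ)
    (hl : ∀ y, ContinuousWithinAt u (Set.Iic y) y) (hi : LocallyIntegrable u volume)
    (h : ∀ φ : ℝ → ℝ, ContDiff ℝ ∞ φ → HasCompactSupport φ →
      -∫ y, ((deriv φ y : ℝ) : ℂ) * u y = ∑ j ∈ s, a j * (φ (x j) : ℂ)) :
    ∃ C : ℂ, ∀ y, u y = C + stepSum s x a y := by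
  have hsi := stepSum_locallyIntegrable s x a
  obtain ⟨C, hC⟩ := ae_eq_const_of_integral_deriv_mul_eq_zero (w := fun y => u y - stepSum s x a y)
    (hi.sub hsi) (by
      intro φ hφ hc
      have hcd := hφ.continuous_deriv (by exact_mod_cast le_top)
      simp only [mul_sub]
      rw [integral_sub (integrable_smul_of_hasCompactSupport hi hcd hc.deriv)
        (integrable_smul_of_hasCompactSupport hsi hcd hc.deriv),
        integral_deriv_mul_stepSum hφ hc, ← h φ hφ hc]
      ring)
  refine ⟨C, fun y => ?_⟩
  have := eq_const_of_leftContinuous_of_ae_eq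
    (fun y => (hl y).sub (stepSum_leftContinuous s x a y)) hC y
  rw [← this, Pi.sub_apply, sub_add_cancel]

lemma stepSum_solves {φ : ℝ → ℝ} (hφ : ContDiff ℝ ∞ φ) (hc : HasCompactSupport φ)
    (s : Finset ℕ) (x : ℕ → ℝ) (a : ℕ → ℂ) (C : ℂ) :
    -∫ y, ((deriv φ y : ℝ) : ℂ) * (C + stepSum s x a y) = ∑ j ∈ s, a j * (φ (x j) : ℂ) := by
  have hcd := hφ.continuous_deriv (by exact_mod_cast le_top)
  simp only [mul_add]
  rw [integral_add (integrable_smul_of_hasCompactSupport (locallyIntegrable_const C) hcd hc.deriv)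
    (integrable_smul_of_hasCompactSupport (stepSum_locallyIntegrable s x a) hcd hc.deriv),
    integral_deriv_mul_const hφ hc, integral_deriv_mul_stepSum hφ hc]
  ring

lemma exists_forall_lt (s : Finset ℕ) (x : ℕ → ℝ) : ∃ M : ℝ, ∀ j ∈ s, |x j| < M := by
  refine ⟨∑ j ∈ s, |x j| + 1, fun j hj => ?_⟩
  have := Finset.single_le_sum (f := fun j => |x j|) (fun i _ => abs_nonneg _) hj
  linarith

lemma stepSum_tendsto_atBot (s : Finset ℕ) (x : ℕ → ℝ) (a : ℕ → ℂ) :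
    Tendsto (stepSum s x a) atBot (𝓝 0) := by
  obtain ⟨M, hM⟩ := exists_forall_lt s x
  refine tendsto_const_nhds.congr' ?_
  filter_upwards [eventually_le_atBot (-M)] with y hy
  refine (Finset.sum_eq_zero fun j hj => ?_).symm
  have := abs_lt.1 (hM j hj)
  rw [if_neg (by linarith)]

lemma stepSum_tendsto_atTop (s : Finset ℕ) (x : ℕ → ℝ) (a : ℕ → ℂ) :
    Tendsto (stepSum s x a) atTop (𝓝 (∑ j ∈ s, a j)) := by
  obtain ⟨M, hM⟩ := exists_forall_lt s x
  refine tendsto_const_nhds.congr' ?_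
  filter_upwards [eventually_ge_atTop M] with y hy
  refine Finset.sum_congr rfl fun j hj => ?_
  have := abs_lt.1 (hM j hj)
  rw [if_pos (by linarith)]

/-! ### Transfer matrices, normalized solution and eigenvalues. -/

/-- The values of a solution between consecutive mass points, starting from `v` at `-∞`. -/
noncomputable def transferState (h g : ℕ → ℝ) (z : ℂ) (v : ℂ × ℂ) : ℕ → ℂ × ℂ
  | 0 => v
  | j + 1 => ((transferState h g z v j).1 + h (j + 1) * (transferState h g z v j).2,
      (transferState h g z v j).2 + -z * g (j + 1) * (transferState h g z v j).1)

/-- The solution of the system that takes the value `v` at `-∞`. -/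
noncomputable def systemSolution (N : ℕ) (m n x : ℕ → ℝ) (z : ℂ) (v : ℂ × ℂ) (y : ℝ) : ℂ × ℂ :=
  (v.1 + stepSum (Finset.Icc 1 N) x (fun j => hWeight m x j *
      (transferState (hWeight m x) (gWeight n x) z v (j - 1)).2) y,
   v.2 + stepSum (Finset.Icc 1 N) x (fun j => -z * gWeight n x j *
      (transferState (hWeight m x) (gWeight n x) z v (j - 1)).1) y)

lemma transferState_eq_sum (h g : ℕ → ℝ) (z : ℂ) (v : ℂ × ℂ) (j : ℕ) :
    transferState h g z v j =
      (v.1 + ∑ i ∈ Finset.Icc 1 j, h i * (transferState h g z v (i - 1)).2,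
       v.2 + ∑ i ∈ Finset.Icc 1 j, -z * g i * (transferState h g z v (i - 1)).1) := by
  induction j with
  | zero => simp [transferState]
  | succ j ih =>
    rw [Finset.sum_Icc_succ_top (by omega), Finset.sum_Icc_succ_top (by omega), ← add_assoc,
      ← add_assoc, Nat.add_sub_cancel]
    rw [transferState]
    ext
    · simp only; nth_rewrite 1 [ih]; rfl
    · simp only; nth_rewrite 1 [ih]; rfl

lemma stepSum_congr {s : Finset ℕ} {x : ℕ → ℝ} {a b : ℕ → ℂ} {y : ℝ}
    (h : ∀ j ∈ s, x j < y → a j = b j) : stepSum s x a y = stepSum s x b y :=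
  Finset.sum_congr rfl fun j hj => by
    by_cases hy : x j < y
    · simp [hy, h j hj hy]
    · simp [hy]

/-- The strict inequality in `stepSum` is left continuity: the jump at `x_j` itself is not yet
counted. -/
lemma stepSum_at_node {N : ℕ} {x : ℕ → ℝ} (hx : StrictMonoOn x (Set.Icc 1 N)) (a : ℕ → ℂ)
    {j : ℕ} (hj : j ∈ Set.Icc 1 N) :
    stepSum (Finset.Icc 1 N) x a (x j) = ∑ i ∈ Finset.Icc 1 (j - 1), a i := by
  rw [stepSum, ← Finset.sum_filter]
  refine Finset.sum_congr ?_ fun _ _ => rfl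
  ext i
  simp only [Finset.mem_filter, Finset.mem_Icc]
  obtain ⟨h1, h2⟩ := hj
  constructor
  · rintro ⟨hi, hlt⟩
    have := (hx.lt_iff_lt (Set.mem_Icc.2 hi) ⟨h1, h2⟩).1 hlt
    omega
  · intro hi
    have hi' : i ∈ Set.Icc 1 N := ⟨hi.1, by omega⟩
    exact ⟨hi', (hx.lt_iff_lt hi' ⟨h1, h2⟩).2 (by omega)⟩

lemma systemSolution_at_node {N : ℕ} {m n x : ℕ → ℝ} (hx : StrictMonoOn x (Set.Icc 1 N)) (z : ℂ)
    (v : ℂ × ℂ) {j : ℕ} (hj : j ∈ Set.Icc 1 N) :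
    systemSolution N m n x z v (x j)
      = transferState (hWeight m x) (gWeight n x) z v (j - 1) := by
  rw [transferState_eq_sum, systemSolution, stepSum_at_node hx _ hj, stepSum_at_node hx _ hj]

lemma systemSolution_solves {N : ℕ} {m n x : ℕ → ℝ} (hx : StrictMonoOn x (Set.Icc 1 N)) (z : ℂ)
    (v : ℂ × ℂ) : SolvesSystem N m n x z (systemSolution N m n x z v) where
  leftContinuous y := ((continuousWithinAt_const.add (stepSum_leftContinuous _ _ _ _)).prodMk
    (continuousWithinAt_const.add (stepSum_leftContinuous _ _ _ _)))
  locallyIntegrable := by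
    intro y
    obtain ⟨s, hs, h1⟩ := ((locallyIntegrable_const v.1).add (stepSum_locallyIntegrable
      (Finset.Icc 1 N) x (fun j => hWeight m x j *
      (transferState (hWeight m x) (gWeight n x) z v (j - 1)).2))) y
    obtain ⟨t, ht, h2⟩ := ((locallyIntegrable_const v.2).add (stepSum_locallyIntegrable
      (Finset.Icc 1 N) x (fun j => -z * gWeight n x j *
      (transferState (hWeight m x) (gWeight n x) z v (j - 1)).1))) y
    exact ⟨s ∩ t, Filter.inter_mem hs ht, (h1.mono_set Set.inter_subset_left).prodMk
      (h2.mono_set Set.inter_subset_right)⟩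
  eq_fst φ hφ hc := by
    have := stepSum_solves hφ hc (Finset.Icc 1 N) x (fun j => hWeight m x j *
      (transferState (hWeight m x) (gWeight n x) z v (j - 1)).2) v.1
    refine Eq.trans this (Finset.sum_congr rfl fun j hj => ?_)
    rw [systemSolution_at_node hx z v (Finset.mem_Icc.1 hj)]
  eq_snd φ hφ hc := by
    have := stepSum_solves hφ hc (Finset.Icc 1 N) x (fun j => -z * gWeight n x j *
      (transferState (hWeight m x) (gWeight n x) z v (j - 1)).1) v.2
    refine Eq.trans this (Finset.sum_congr rfl fun j hj => ?_)
    rw [systemSolution_at_node hx z v (Finset.mem_Icc.1 hj)]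

/-- Each component is a constant plus a step function whose jumps involve the values at the nodes.
The value at `x_j` depends only on earlier nodes, so strong induction on `j` fixes all jumps. -/
lemma SolvesSystem.exists_eq {N : ℕ} {m n x : ℕ → ℝ} (hx : StrictMonoOn x (Set.Icc 1 N)) {z : ℂ}
    {Φ : ℝ → ℂ × ℂ} (h : SolvesSystem N m n x z Φ) : ∃ v, Φ = systemSolution N m n x z v := by
  obtain ⟨C₁, h1⟩ := eq_const_add_stepSum (u := fun y => (Φ y).1) (Finset.Icc 1 N) x
    (fun j => hWeight m x j * (Φ (x j)).2) (fun y => (h.leftContinuous y).fst)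
    (fun y => let ⟨s, hs, hi⟩ := h.locallyIntegrable y; ⟨s, hs, hi.fst⟩) h.eq_fst
  obtain ⟨C₂, h2⟩ := eq_const_add_stepSum (u := fun y => (Φ y).2) (Finset.Icc 1 N) x
    (fun j => -z * gWeight n x j * (Φ (x j)).1) (fun y => (h.leftContinuous y).snd)
    (fun y => let ⟨s, hs, hi⟩ := h.locallyIntegrable y; ⟨s, hs, hi.snd⟩) h.eq_snd
  have key : ∀ j ∈ Set.Icc 1 N,
      Φ (x j) = transferState (hWeight m x) (gWeight n x) z (C₁, C₂) (j - 1) := by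
    intro j
    induction j using Nat.strong_induction_on with
    | _ j ih =>
      intro hj
      rw [transferState_eq_sum]
      ext
      · rw [h1, stepSum_at_node hx _ hj]
        refine congrArg _ (Finset.sum_congr rfl fun i hi => ?_)
        have := Finset.mem_Icc.1 hi
        rw [ih i (by omega) ⟨this.1, by have := hj.2; omega⟩]
      · rw [h2, stepSum_at_node hx _ hj]
        refine congrArg _ (Finset.sum_congr rfl fun i hi => ?_)
        have := Finset.mem_Icc.1 hi
        rw [ih i (by omega) ⟨this.1, by have := hj.2; omega⟩]
  refine ⟨(C₁, C₂), funext fun y => ?_⟩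
  ext
  · rw [h1]
    exact congrArg _ (stepSum_congr fun j hj _ => by rw [key j (Finset.mem_Icc.1 hj)])
  · rw [h2]
    exact congrArg _ (stepSum_congr fun j hj _ => by rw [key j (Finset.mem_Icc.1 hj)])

lemma systemSolution_tendsto_atBot (N : ℕ) (m n x : ℕ → ℝ) (z : ℂ) (v : ℂ × ℂ) :
    Tendsto (systemSolution N m n x z v) atBot (𝓝 v) := by
  have := (tendsto_const_nhds (x := v.1)).add (stepSum_tendsto_atBot (Finset.Icc 1 N) x
    (fun j => hWeight m x j * (transferState (hWeight m x) (gWeight n x) z v (j - 1)).2))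
  have h2 := (tendsto_const_nhds (x := v.2)).add (stepSum_tendsto_atBot (Finset.Icc 1 N) x
    (fun j => -z * gWeight n x j * (transferState (hWeight m x) (gWeight n x) z v (j - 1)).1))
  rw [add_zero] at this h2
  exact this.prodMk_nhds h2

lemma systemSolution_tendsto_atTop (N : ℕ) (m n x : ℕ → ℝ) (z : ℂ) (v : ℂ × ℂ) :
    Tendsto (systemSolution N m n x z v) atTop
      (𝓝 (transferState (hWeight m x) (gWeight n x) z v N)) := by
  rw [transferState_eq_sum]
  exact (tendsto_const_nhds.add (stepSum_tendsto_atTop _ _ _)).prodMk_nhds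
    (tendsto_const_nhds.add (stepSum_tendsto_atTop _ _ _))

/-- Both components at `+∞` of the normalized solution, as polynomials in the spectral
parameter. -/
noncomputable def transferPoly (h g : ℕ → ℝ) : ℕ → Polynomial ℝ × Polynomial ℝ
  | 0 => (0, 1)
  | j + 1 => ((transferPoly h g j).1 + Polynomial.C (h (j + 1)) * (transferPoly h g j).2,
      (transferPoly h g j).2 - Polynomial.C (g (j + 1)) * Polynomial.X * (transferPoly h g j).1)

lemma transferState_eq_aeval (h g : ℕ → ℝ) (z a : ℂ) (j : ℕ) :
    transferState h g z (0, a) j = (a * Polynomial.aeval z (transferPoly h g j).1,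
      a * Polynomial.aeval z (transferPoly h g j).2) := by
  induction j with
  | zero => simp [transferState, transferPoly]
  | succ j ih =>
    rw [transferState, ih, transferPoly]
    ext
    · simp; ring
    · simp; ring

/-- A solution is determined by its limit at `-∞`, and every limit is attained. -/
lemma isNormalizedSolution_iff {N : ℕ} {m n x : ℕ → ℝ} (hx : StrictMonoOn x (Set.Icc 1 N)) (z : ℂ)
    (Φ : ℝ → ℂ × ℂ) :
    IsNormalizedSolution N m n x z Φ ↔ Φ = systemSolution N m n x z (0, 1) := by
  constructor
  · rintro ⟨h1, h2⟩
    obtain ⟨v, rfl⟩ := h1.exists_eq hx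
    rw [tendsto_nhds_unique (systemSolution_tendsto_atBot N m n x z v) h2]
  · rintro rfl
    exact ⟨systemSolution_solves hx z _, systemSolution_tendsto_atBot N m n x z _⟩

/-- The boundary condition at `-∞` leaves the multiples of the normalized solution by a scalar `a`;
the second component at `+∞` is then `a P(z)`, and `a = 0` gives the zero solution. -/
lemma isEigenvalueBVP_iff {N : ℕ} {m n x : ℕ → ℝ} (hx : StrictMonoOn x (Set.Icc 1 N)) (z : ℂ) :
    IsEigenvalueBVP N m n x z ↔
      Polynomial.aeval z (transferPoly (hWeight m x) (gWeight n x) N).2 = 0 := by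
  constructor
  · rintro ⟨Φ, h1, h0, h2, h3⟩
    obtain ⟨⟨v, a⟩, rfl⟩ := h1.exists_eq hx
    have hv : v = 0 := tendsto_nhds_unique
      ((continuous_fst.tendsto _).comp (systemSolution_tendsto_atBot N m n x z (v, a))) h2
    subst hv
    have ht := tendsto_nhds_unique
      ((continuous_snd.tendsto _).comp (systemSolution_tendsto_atTop N m n x z (0, a))) h3
    rw [transferState_eq_aeval] at ht
    rcases mul_eq_zero.1 ht with ha | ha
    · exfalso
      apply h0
      subst ha
      ext y <;> simp [systemSolution, stepSum, transferState_eq_aeval]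
    · exact ha
  · intro h
    refine ⟨systemSolution N m n x z (0, 1), systemSolution_solves hx z _, ?_, ?_, ?_⟩
    · intro h0
      have := systemSolution_tendsto_atBot N m n x z (0, 1)
      rw [h0] at this
      have h2 := tendsto_nhds_unique (tendsto_const_nhds (x := (0 : ℂ × ℂ))) this
      simpa using congrArg Prod.snd h2
    · exact (continuous_fst.tendsto _).comp (systemSolution_tendsto_atBot N m n x z (0, 1))
    · have := (continuous_snd.tendsto _).comp (systemSolution_tendsto_atTop N m n x z (0, 1))
      rw [transferState_eq_aeval, h, mul_zero] at this
      exact this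

/-! ### Interlacing and signs of the transfer polynomials. -/

open Polynomial in
/-- The polynomial with constant coefficient `1` and the roots `a_1, …, a_K`. -/
noncomputable def nodePoly (a : ℕ → ℝ) (K : ℕ) : ℝ[X] :=
  ∏ i ∈ Finset.range K, (1 - C (a (i + 1))⁻¹ * X)

lemma lt_of_forall_lt_succ {a : ℕ → ℝ} {K : ℕ} (ha : ∀ i < K, a i < a (i + 1)) {i j : ℕ}
    (hij : i < j) (hj : j ≤ K) : a i < a j := by
  induction j, hij using Nat.le_induction with
  | base => exact ha i (by omega)
  | succ j hij ih => exact (ih (by omega)).trans (ha j (by omega))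

/-- Exactly the `j` factors whose root lies below `t` are negative. The index set is kept general in
order to cover both the full product and the product with one factor removed. -/
lemma neg_one_pow_mul_prod_pos {j : ℕ} {a : ℕ → ℝ} {t : ℝ} {s : Finset ℕ}
    (hs : ∀ i ∈ s, 0 < a (i + 1)) (hj : (s.filter (· < j)).card = j)
    (hlt : ∀ i ∈ s, i < j → a (i + 1) < t) (hgt : ∀ i ∈ s, ¬ i < j → t < a (i + 1)) :
    0 < (-1 : ℝ) ^ j * ∏ i ∈ s, (1 - (a (i + 1))⁻¹ * t) := by
  have e : (-1 : ℝ) ^ j = ∏ i ∈ s, if i < j then (-1 : ℝ) else 1 := by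
    rw [Finset.prod_ite, Finset.prod_const, Finset.prod_const, hj, one_pow, mul_one]
  rw [e, ← Finset.prod_mul_distrib]
  refine Finset.prod_pos fun i hi => ?_
  have hp := hs i hi
  split_ifs with h
  · have := hlt i hi h
    have : 1 < (a (i + 1))⁻¹ * t := by rw [inv_mul_eq_div, one_lt_div hp]; exact this
    linarith
  · have := hgt i hi h
    have : (a (i + 1))⁻¹ * t < 1 := by rw [inv_mul_eq_div, div_lt_one hp]; exact this
    linarith

lemma eval_nodePoly (a : ℕ → ℝ) (K : ℕ) (t : ℝ) :
    (nodePoly a K).eval t = ∏ i ∈ Finset.range K, (1 - (a (i + 1))⁻¹ * t) := by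
  simp [nodePoly, Polynomial.eval_prod]

lemma neg_one_pow_mul_eval_nodePoly_pos {K j : ℕ} {a : ℕ → ℝ} {t : ℝ} (h0 : 0 ≤ a 0)
    (ha : ∀ i < K, a i < a (i + 1)) (hj : j ≤ K) (hlt : a j < t) (hgt : j < K → t < a (j + 1)) :
    0 < (-1 : ℝ) ^ j * (nodePoly a K).eval t := by
  rw [eval_nodePoly]
  refine neg_one_pow_mul_prod_pos ?_ ?_ ?_ ?_
  · intro i hi
    exact h0.trans_lt (lt_of_forall_lt_succ ha (Nat.succ_pos i) (Finset.mem_range.1 hi))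
  · have : (Finset.range K).filter (· < j) = Finset.range j := by
      ext i; simp only [Finset.mem_filter, Finset.mem_range]; omega
    rw [this, Finset.card_range]
  · intro i _ hij
    rcases Nat.lt_or_ge (i + 1) j with h | h
    · exact (lt_of_forall_lt_succ ha h hj).trans hlt
    · rwa [show i + 1 = j by omega]
  · intro i hi hij
    have hiK := Finset.mem_range.1 hi
    refine (hgt (by omega)).trans_le ?_
    rcases Nat.lt_or_ge j i with h | h
    · exact (lt_of_forall_lt_succ ha (show j + 1 < i + 1 by omega) hiK).le
    · rw [show i = j by omega]

lemma natDegree_one_sub_C_mul_X_le (u : ℝ) :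
    (1 - Polynomial.C u * Polynomial.X : Polynomial ℝ).natDegree ≤ 1 := by
  compute_degree

lemma natDegree_nodePoly_le (a : ℕ → ℝ) (K : ℕ) : (nodePoly a K).natDegree ≤ K := by
  refine (Polynomial.natDegree_prod_le _ _).trans ?_
  refine (Finset.sum_le_card_nsmul _ _ 1 fun i _ => natDegree_one_sub_C_mul_X_le _).trans ?_
  simp

lemma neg_one_pow_mul_coeff_nodePoly_pos {a : ℕ → ℝ} {K : ℕ} (h : ∀ i < K, 0 < a (i + 1)) :
    0 < (-1 : ℝ) ^ K * (nodePoly a K).coeff K := by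
  have := Polynomial.coeff_prod_of_natDegree_le (Finset.range K)
    (fun i => (1 - Polynomial.C (a (i + 1))⁻¹ * Polynomial.X : Polynomial ℝ)) 1
    fun i _ => natDegree_one_sub_C_mul_X_le _
  rw [Finset.card_range, mul_one] at this
  rw [nodePoly, this]
  nth_rewrite 1 [← Finset.card_range K]
  rw [← Finset.prod_const, ← Finset.prod_mul_distrib]
  refine Finset.prod_pos fun i hi => ?_
  have := h i (Finset.mem_range.1 hi)
  rw [Polynomial.coeff_sub, Polynomial.coeff_C_mul, Polynomial.coeff_X_one, Polynomial.coeff_one]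
  simpa using this

/-- Both sides have degree at most `K` and agree at the `K + 1` points `0, a_1, …, a_K`; the
convention `a 0 = 0` supplies the extra point. -/
lemma eq_nodePoly {a : ℕ → ℝ} {K : ℕ} {F : Polynomial ℝ} (h0 : a 0 = 0)
    (ha : ∀ i < K, a i < a (i + 1)) (hd : F.natDegree ≤ K) (h1 : F.eval 0 = 1)
    (hr : ∀ i < K, F.eval (a (i + 1)) = 0) : F = nodePoly a K := by
  refine Polynomial.eq_of_degree_sub_lt_of_eval_index_eq (v := a) (Finset.range (K + 1)) ?_ ?_ ?_
  · intro i hi j hj hij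
    simp only [Finset.coe_range, Set.mem_Iio] at hi hj
    rcases lt_trichotomy i j with h | h | h
    · exact absurd hij (lt_of_forall_lt_succ ha h (by omega)).ne
    · exact h
    · exact absurd hij (lt_of_forall_lt_succ ha h (by omega)).ne'
  · rw [Finset.card_range]
    refine lt_of_le_of_lt (Polynomial.degree_le_of_natDegree_le (n := K) ?_)
      (by exact_mod_cast Nat.lt_succ_self K)
    exact (Polynomial.natDegree_sub_le _ _).trans (max_le hd (natDegree_nodePoly_le a K))
  · intro i hi
    cases i with
    | zero => rw [h0, h1, eval_nodePoly]; simp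
    | succ i =>
      have hi' : i < K := by simpa using hi
      rw [hr i hi', eval_nodePoly]
      refine (Finset.prod_eq_zero (Finset.mem_range.2 hi') ?_).symm
      have : 0 < a (i + 1) := h0 ▸ lt_of_forall_lt_succ ha (Nat.succ_pos i) hi'
      rw [inv_mul_cancel₀ this.ne', sub_self]

lemma exists_roots_of_alternating {F : Polynomial ℝ} {a : ℕ → ℝ} {L : ℕ}
    (ha : ∀ i < L, a i < a (i + 1)) (hs : ∀ i ≤ L, 0 < (-1 : ℝ) ^ i * F.eval (a i)) :
    ∃ r : ℕ → ℝ, ∀ i < L, a i < r i ∧ r i < a (i + 1) ∧ F.eval (r i) = 0 := by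
  have : ∀ i, ∃ t, i < L → a i < t ∧ t < a (i + 1) ∧ F.eval t = 0 := by
    intro i
    by_cases hi : i < L
    · have h1 := hs i hi.le
      have h2 := hs (i + 1) hi
      rw [pow_succ, mul_assoc, neg_one_mul, mul_neg] at h2
      have hc : ContinuousOn (fun t => (-1 : ℝ) ^ i * F.eval t) (Set.Icc (a i) (a (i + 1))) :=
        (continuous_const.mul F.continuous).continuousOn
      obtain ⟨t, ht, h⟩ := intermediate_value_Ioo' (ha i hi).le hc
        (show (0 : ℝ) ∈ _ from ⟨by linarith, h1⟩)
      exact ⟨t, fun _ => ⟨ht.1, ht.2, (mul_eq_zero.1 h).resolve_left (by simp)⟩⟩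
    · exact ⟨0, fun h => absurd h hi⟩
  choose r hr using this
  exact ⟨r, hr⟩

lemma exists_gt_eval_pos {F : Polynomial ℝ} {L : ℕ} (hd : F.natDegree ≤ L + 1) {σ : ℝ}
    (hσ : 0 < σ * F.coeff (L + 1)) (t₀ : ℝ) : ∃ t, t₀ < t ∧ 0 < σ * F.eval t := by
  have hF : F.natDegree = L + 1 := le_antisymm hd
    (Polynomial.le_natDegree_of_ne_zero (right_ne_zero_of_mul hσ.ne'))
  have hσ0 : σ ≠ 0 := left_ne_zero_of_mul hσ.ne'
  have hG : (Polynomial.C σ * F).natDegree = L + 1 := by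
    rw [Polynomial.natDegree_C_mul hσ0, hF]
  have ht := (Polynomial.C σ * F).tendsto_atTop_of_leadingCoeff_nonneg
    (Polynomial.natDegree_pos_iff_degree_pos.1 (by omega))
    (by rw [Polynomial.leadingCoeff, hG, Polynomial.coeff_C_mul]; exact hσ.le)
  obtain ⟨t, h1, h2⟩ := ((ht.eventually_gt_atTop 0).and (eventually_gt_atTop t₀)).exists
  exact ⟨t, h2, by simpa using h1⟩

/-- The positive roots `a_1 < ⋯ < a_{⌊n/2⌋}` of `P` together with the alternation of `Q`. -/
structure Interlacing (n : ℕ) (Q P : Polynomial ℝ) (a : ℕ → ℝ) : Prop where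
  zero : a 0 = 0
  eq_zero : n = 0 → Q = 0
  lt_succ : ∀ i < n / 2, a i < a (i + 1)
  eq_nodePoly : P = nodePoly a (n / 2)
  alternating : ∀ i < n / 2, 0 < (-1 : ℝ) ^ i * Q.eval (a (i + 1))
  natDegree_le : Q.natDegree ≤ (n - 1) / 2
  coeff_pos : Odd n → 0 < (-1 : ℝ) ^ (n / 2) * Q.coeff (n / 2)

open Polynomial in
lemma Interlacing.step {n : ℕ} {Q P : ℝ[X]} {a : ℕ → ℝ} (H : Interlacing n Q P a) {h g : ℝ}
    (hh : 0 < h) (hg : 0 < g) :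
    ∃ a', Interlacing (n + 1) (Q + C h * P) (P - C g * X * Q) a' := by
  have hlt := fun {i j} => lt_of_forall_lt_succ (i := i) (j := j) H.lt_succ
  have hpos : ∀ i < n / 2, 0 < a (i + 1) := fun i hi => H.zero ▸ hlt (Nat.succ_pos i) hi
  have hP1 : P.eval 0 = 1 := by rw [H.eq_nodePoly, eval_nodePoly]; simp
  have hPr : ∀ i < n / 2, P.eval (a (i + 1)) = 0 := fun i hi => by
    rw [H.eq_nodePoly, eval_nodePoly]
    refine Finset.prod_eq_zero (Finset.mem_range.2 hi) ?_
    rw [inv_mul_cancel₀ (hpos i hi).ne', sub_self]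
  have hPd : P.natDegree ≤ n / 2 := H.eq_nodePoly ▸ natDegree_nodePoly_le _ _
  have hgXQ : (C g * X * Q).natDegree ≤ 1 + (n - 1) / 2 :=
    natDegree_mul_le.trans (Nat.add_le_add (by compute_degree) H.natDegree_le)
  have hcoe : ∀ i, (C g * X * Q).coeff (i + 1) = g * Q.coeff i := fun i => by
    rw [mul_assoc, coeff_C_mul, coeff_X_mul]
  set F := P - C g * X * Q with hF
  have hF0 : F.eval 0 = 1 := by simp [hF, hP1]
  have hFs : ∀ i ≤ n / 2, 0 < (-1 : ℝ) ^ i * F.eval (a i) := by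
    intro i hi
    cases i with
    | zero => rw [H.zero, hF0]; norm_num
    -- At a zero of `P` only `-g X Q` survives in `F`, so `F` takes the sign opposite to that of
    -- `Q`.
    | succ i =>
      have h1 := H.alternating i hi
      have h2 := hpos i hi
      have : (-1 : ℝ) ^ (i + 1) * F.eval (a (i + 1))
          = g * a (i + 1) * ((-1 : ℝ) ^ i * Q.eval (a (i + 1))) := by
        simp [hF, hPr i hi, pow_succ]; ring
      rw [this]; exact mul_pos (mul_pos hg h2) h1
  -- Points where `F` alternates in sign: `0` and the zeros of `P`. For odd `n` the degree bound for
  -- `F` is one higher than that for `P`, and its leading coefficient forces one more sign change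
  -- far to the right.
  obtain ⟨A, hA0, hAeq, hAlt, hAs⟩ : ∃ A : ℕ → ℝ, A 0 = 0 ∧ (∀ i ≤ n / 2, A i = a i) ∧
      (∀ i < (n + 1) / 2, A i < A (i + 1)) ∧
      ∀ i ≤ (n + 1) / 2, 0 < (-1 : ℝ) ^ i * F.eval (A i) := by
    rcases Nat.even_or_odd' n with ⟨K, rfl | rfl⟩
    · exact ⟨a, H.zero, fun _ _ => rfl, fun i hi => H.lt_succ i (by omega),
        fun i hi => hFs i (by omega)⟩
    · have eK : (2 * K + 1) / 2 = K := by omega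
      have eK' : (2 * K + 1 + 1) / 2 = K + 1 := by omega
      rw [eK']
      have hcoeff : 0 < (-1 : ℝ) ^ (K + 1) * F.coeff (K + 1) := by
        have h1 := H.coeff_pos ⟨K, rfl⟩
        rw [eK] at h1
        have : (-1 : ℝ) ^ (K + 1) * F.coeff (K + 1) = g * ((-1) ^ K * Q.coeff K) := by
          rw [hF, coeff_sub, hcoe, coeff_eq_zero_of_natDegree_lt (p := P) (by omega), pow_succ]
          ring
        rw [this]; exact mul_pos hg h1
      have hd : F.natDegree ≤ K + 1 :=
        (natDegree_sub_le _ _).trans (max_le (by omega) (hgXQ.trans (by omega)))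
      obtain ⟨t, ht1, ht2⟩ := exists_gt_eval_pos hd hcoeff (a K)
      refine ⟨fun i => if i ≤ K then a i else t, by simp [H.zero], fun i hi => if_pos (hi.trans eK.le), ?_, ?_⟩
      · intro i hi
        rcases Nat.lt_or_ge i K with h | h
        · simp only [if_pos h.le, if_pos (show i + 1 ≤ K from h)]
          exact H.lt_succ i (by omega)
        · obtain rfl : i = K := by omega
          simpa using ht1
      · intro i hi
        rcases Nat.lt_or_ge K i with h | h
        · obtain rfl : i = K + 1 := by omega
          simpa using ht2
        · simp only [if_pos h]
          exact hFs i (by omega)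
  obtain ⟨r, hr⟩ := exists_roots_of_alternating hAlt hAs
  have hAmono := fun {i j} => lt_of_forall_lt_succ (i := i) (j := j) hAlt
  have hA0le : ∀ i ≤ (n + 1) / 2, 0 ≤ A i := fun i hi => by
    rcases Nat.eq_zero_or_pos i with rfl | h
    · exact hA0.ge
    · exact hA0 ▸ (hAmono h hi).le
  have hrpos : ∀ i < (n + 1) / 2, 0 < r i := fun i hi => (hA0le i hi.le).trans_lt (hr i hi).1
  have hlt' : ∀ i < (n + 1) / 2, (fun i => Nat.casesOn i 0 r : ℕ → ℝ) i
      < (fun i => Nat.casesOn i 0 r : ℕ → ℝ) (i + 1) := by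
    intro i hi
    cases i with
    | zero => exact hrpos 0 hi
    | succ i => exact (hr i (by omega)).2.1.trans (hr (i + 1) hi).1
  have hFd : F.natDegree ≤ (n + 1) / 2 :=
    (natDegree_sub_le _ _).trans (max_le (by omega) (by
      -- For `n = 0` the truncated `(n - 1) / 2` is `0`, which alone would allow degree `1` here;
      -- `eq_zero` excludes this.
      rcases Nat.eq_zero_or_pos n with h0 | h0
      · rw [H.eq_zero h0, mul_zero, natDegree_zero]; exact Nat.zero_le _
      · exact hgXQ.trans (by omega)))
  refine ⟨fun i => Nat.casesOn i 0 r, rfl, fun h => absurd h (Nat.succ_ne_zero n), hlt', ?_, ?_, ?_, ?_⟩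
  · exact _root_.eq_nodePoly rfl hlt' hFd hF0 fun i hi => (hr i hi).2.2
  · intro i hi
    show 0 < (-1 : ℝ) ^ i * (Q + C h * P).eval (r i)
    have h1 : F.eval (r i) = 0 := (hr i hi).2.2
    -- At a zero of `F`, `Q` has the sign of `P`, and that sign is known from the two zeros of `P`
    -- around `r i`.
    have h2 : P.eval (r i) = g * r i * Q.eval (r i) := by
      simp [hF] at h1; linarith
    have h3 : 0 < (-1 : ℝ) ^ i * P.eval (r i) := by
      rw [H.eq_nodePoly]
      refine neg_one_pow_mul_eval_nodePoly_pos H.zero.ge H.lt_succ (by omega) ?_ ?_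
      · rw [← hAeq i (by omega)]; exact (hr i hi).1
      · intro hi'
        rw [← hAeq (i + 1) (by omega)]; exact (hr i hi).2.1
    have h4 := hrpos i hi
    have h5 : 0 < (-1 : ℝ) ^ i * Q.eval (r i) := by
      rw [h2] at h3
      have : (-1 : ℝ) ^ i * (g * r i * Q.eval (r i))
        = (g * r i) * ((-1 : ℝ) ^ i * Q.eval (r i)) := by ring
      rw [this] at h3
      exact (mul_pos_iff_of_pos_left (by positivity)).1 h3
    rw [eval_add, eval_mul, eval_C, mul_add, mul_left_comm]
    exact add_pos h5 (mul_pos hh h3)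
  · refine (natDegree_add_le _ _).trans (max_le (H.natDegree_le.trans (by omega)) ?_)
    exact (natDegree_C_mul_le _ _).trans (hPd.trans (by omega))
  · intro hodd
    have e1 : (n + 1) / 2 = n / 2 := by
      obtain ⟨j, hj⟩ := hodd; omega
    have h2 : 0 < (-1 : ℝ) ^ (n / 2) * P.coeff (n / 2) := by
      rw [H.eq_nodePoly]; exact neg_one_pow_mul_coeff_nodePoly_pos hpos
    have h3 : Q.coeff (n / 2) = 0 := by
      rcases Nat.eq_zero_or_pos n with h0 | h0
      · rw [H.eq_zero h0, coeff_zero]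
      · refine coeff_eq_zero_of_natDegree_lt (H.natDegree_le.trans_lt ?_)
        obtain ⟨j, hj⟩ := hodd; omega
    rw [e1, coeff_add, coeff_C_mul, h3, zero_add, mul_left_comm]
    exact mul_pos hh h2

lemma exists_interlacing {N : ℕ} {h g : ℕ → ℝ} (hh : ∀ j ∈ Set.Icc 1 N, 0 < h j)
    (hg : ∀ j ∈ Set.Icc 1 N, 0 < g j) :
    ∃ a, Interlacing N (transferPoly h g N).1 (transferPoly h g N).2 a := by
  induction N with
  | zero =>
    exact ⟨fun _ => 0, rfl, fun _ => rfl, fun i hi => absurd hi (by simp), by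
      simp [transferPoly, nodePoly], fun i hi => absurd hi (by simp), by simp [transferPoly],
      fun h => absurd h (by simp)⟩
  | succ N ih =>
    obtain ⟨a, ha⟩ := ih (fun j hj => hh j ⟨hj.1, hj.2.trans N.le_succ⟩)
      (fun j hj => hg j ⟨hj.1, hj.2.trans N.le_succ⟩)
    exact ha.step (hh (N + 1) ⟨by omega, le_rfl⟩) (hg (N + 1) ⟨by omega, le_rfl⟩)

/-! ### Spectral data as a partial fraction decomposition. -/

section

lemma SpectralData.integral_measure {K : ℕ} (S : SpectralData K) (hb : ∀ j, 0 ≤ S.b j)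
    {E : Type*} [NormedAddCommGroup E] [NormedSpace ℝ E] [CompleteSpace E] (f : ℝ → E) :
    ∫ s, f s ∂S.measure = ∑ j, S.b j • f (S.ζ j) := by
  rw [SpectralData.measure, integral_finsetSum_measure]
  · refine Finset.sum_congr rfl fun j _ => ?_
    rw [integral_smul_measure, integral_dirac, ENNReal.toReal_ofReal (hb j)]
  · intro j _
    exact (integrable_dirac (by simp)).smul_measure ENNReal.ofReal_ne_top

open Polynomial

/-- The polynomial with constant coefficient `1` and the roots `ζ_i`. -/
noncomputable def rootPoly {K : ℕ} (ζ : Fin K → ℝ) : ℝ[X] := ∏ i, (1 - C (ζ i)⁻¹ * X)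

/-- The quotient of `rootPoly ζ` by `ζ_j - X`. -/
noncomputable def rootCofactor {K : ℕ} (ζ : Fin K → ℝ) (j : Fin K) : ℝ[X] :=
  C (ζ j)⁻¹ * ∏ i ∈ Finset.univ.erase j, (1 - C (ζ i)⁻¹ * X)

lemma sub_mul_rootCofactor {K : ℕ} {ζ : Fin K → ℝ} {j : Fin K} (h : ζ j ≠ 0) :
    (C (ζ j) - X) * rootCofactor ζ j = rootPoly ζ := by
  rw [rootPoly, ← Finset.mul_prod_erase _ _ (Finset.mem_univ j), rootCofactor, ← mul_assoc,
    sub_mul, ← C_mul, mul_inv_cancel₀ h, C_1, mul_comm X]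

lemma eval_rootPoly_self {K : ℕ} {ζ : Fin K → ℝ} {j : Fin K} (h : ζ j ≠ 0) :
    (rootPoly ζ).eval (ζ j) = 0 := by
  rw [← sub_mul_rootCofactor h]; simp

lemma eval_rootCofactor_of_ne {K : ℕ} {ζ : Fin K → ℝ} {i j : Fin K} (hij : i ≠ j)
    (h : ζ i ≠ 0) : (rootCofactor ζ j).eval (ζ i) = 0 := by
  rw [rootCofactor, eval_mul, eval_prod, Finset.prod_eq_zero (i := i), mul_zero]
  · simp [hij]
  · simp [h]

lemma eval_rootCofactor_self_ne_zero {K : ℕ} {ζ : Fin K → ℝ} {j : Fin K} (h : ∀ i, ζ i ≠ 0)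
    (hinj : Function.Injective ζ) : (rootCofactor ζ j).eval (ζ j) ≠ 0 := by
  rw [rootCofactor, eval_mul, eval_prod, eval_C]
  refine mul_ne_zero (inv_ne_zero (h j)) (Finset.prod_ne_zero_iff.2 fun i hi => ?_)
  have hij : i ≠ j := Finset.ne_of_mem_erase hi
  simp only [eval_sub, eval_one, eval_mul, eval_C, eval_X]
  intro h0
  apply hij
  apply hinj
  have := h i
  field_simp at h0
  linarith

lemma aeval_rootPoly_eq_zero_iff {K : ℕ} {ζ : Fin K → ℝ} (h : ∀ i, ζ i ≠ 0) (z : ℂ) :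
    aeval z (rootPoly ζ) = 0 ↔ ∃ j, z = (ζ j : ℂ) := by
  rw [rootPoly, map_prod, Finset.prod_eq_zero_iff]
  simp only [Finset.mem_univ, true_and, map_sub, map_one, map_mul, aeval_C, aeval_X,
    Complex.coe_algebraMap]
  refine exists_congr fun j => ?_
  have : (ζ j : ℂ) ≠ 0 := by exact_mod_cast h j
  push_cast
  constructor
  · intro h0
    field_simp at h0
    linear_combination -h0
  · rintro rfl
    rw [inv_mul_cancel₀ this, sub_self]

lemma natDegree_rootPoly_le {K : ℕ} (ζ : Fin K → ℝ) : (rootPoly ζ).natDegree ≤ K := by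
  refine (natDegree_prod_le _ _).trans ?_
  refine (Finset.sum_le_card_nsmul _ _ 1 fun i _ => natDegree_one_sub_C_mul_X_le _).trans ?_
  simp

lemma natDegree_rootCofactor_lt {K : ℕ} (ζ : Fin K → ℝ) (j : Fin K) :
    (rootCofactor ζ j).natDegree < K := by
  refine lt_of_le_of_lt ((natDegree_C_mul_le _ _).trans (natDegree_prod_le _ _)) ?_
  refine lt_of_le_of_lt
    (Finset.sum_le_card_nsmul _ _ 1 fun i _ => natDegree_one_sub_C_mul_X_le _) ?_
  have := j.pos
  simp; omega

/-- The partial fraction decomposition `Q / P = c + ∑ b_j / (ζ_j - z)`, without denominators. -/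
structure SpectralData.Represents {K : ℕ} (S : SpectralData K) (Q P : ℝ[X]) : Prop where
  den : P = rootPoly S.ζ
  num : Q = C S.c * P + ∑ j, C (S.b j) * rootCofactor S.ζ j

/-- Evaluation at `ζ_j` isolates `b_j`, since `P` and all other cofactors vanish there; evaluation
at `0`, where `P = 1`, then isolates `c`. -/
lemma SpectralData.Represents.unique {K : ℕ} {S T : SpectralData K} {Q P : ℝ[X]}
    (hS : S.Represents Q P) (hT : T.Represents Q P) (hζ : S.ζ = T.ζ) (h0 : ∀ i, S.ζ i ≠ 0)
    (hinj : Function.Injective S.ζ) : S = T := by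
  have hb : S.b = T.b := by
    funext j
    have h1 := congrArg (eval (S.ζ j)) hS.num
    have h2 := congrArg (eval (S.ζ j)) hT.num
    have hP : P.eval (S.ζ j) = 0 := by rw [hS.den, eval_rootPoly_self (h0 j)]
    rw [← hζ] at h2
    rw [eval_add, eval_mul, hP, mul_zero, zero_add, eval_finsetSum,
      Finset.sum_eq_single j (fun i _ hij => by
        rw [eval_mul, eval_rootCofactor_of_ne hij.symm (h0 j), mul_zero])
        (fun h => absurd (Finset.mem_univ j) h), eval_mul, eval_C] at h1 h2
    exact mul_right_cancel₀ (eval_rootCofactor_self_ne_zero h0 hinj) (h1.symm.trans h2)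
  have hc : S.c = T.c := by
    have h1 := congrArg (eval 0) hS.num
    have h2 := congrArg (eval 0) hT.num
    rw [h1, ← hζ, ← hb, eval_add, eval_add, add_left_inj, eval_mul, eval_mul, hS.den] at h2
    simpa [rootPoly, eval_prod] using h2
  exact SpectralData.ext hζ hb hc

lemma SpectralData.Represents.aeval_div {K : ℕ} {S : SpectralData K} {Q P : ℝ[X]}
    (hS : S.Represents Q P) (h0 : ∀ i, S.ζ i ≠ 0) {z : ℂ} (hz : aeval z P ≠ 0) :
    aeval z Q / aeval z P = (S.c : ℂ) + ∑ j, (S.b j : ℂ) * (1 / ((S.ζ j : ℂ) - z)) := by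
  rw [div_eq_iff hz, add_mul, Finset.sum_mul]
  nth_rewrite 1 [hS.num]
  rw [map_add, map_mul, aeval_C, map_sum, Complex.coe_algebraMap]
  refine congrArg _ (Finset.sum_congr rfl fun j _ => ?_)
  have hne : (S.ζ j : ℂ) - z ≠ 0 := fun h => hz (by
    rw [hS.den, aeval_rootPoly_eq_zero_iff h0]; exact ⟨j, by linear_combination -h⟩)
  have : aeval z P = ((S.ζ j : ℂ) - z) * aeval z (rootCofactor S.ζ j) := by
    rw [hS.den, ← sub_mul_rootCofactor (h0 j)]; simp
  rw [map_mul, aeval_C, this, Complex.coe_algebraMap]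
  field_simp

lemma polynomial_eq_of_aeval_eq {F G : ℝ[X]} {s : Set ℂ} (hs : s.Finite)
    (h : ∀ z ∉ s, aeval z F = aeval z G) : F = G := by
  refine map_injective (algebraMap ℝ ℂ) (algebraMap ℝ ℂ).injective ?_
  refine eq_of_infinite_eval_eq _ _ (Set.Infinite.mono (s := sᶜ) ?_ hs.infinite_compl)
  intro z hz
  simpa [eval_map_algebraMap] using h z hz

lemma SpectralData.represents_of_aeval_div {K : ℕ} {S : SpectralData K} {Q P : ℝ[X]}
    (h0 : ∀ i, S.ζ i ≠ 0) (hP : P = rootPoly S.ζ)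
    (h : ∀ z : ℂ, aeval z P ≠ 0 →
      aeval z Q / aeval z P = (S.c : ℂ) + ∑ j, (S.b j : ℂ) * (1 / ((S.ζ j : ℂ) - z))) :
    S.Represents Q P := by
  refine ⟨hP, polynomial_eq_of_aeval_eq (s := Set.range fun j => (S.ζ j : ℂ))
    (Set.finite_range _) fun z hz => ?_⟩
  have hz' : aeval z P ≠ 0 := fun h' => hz (by
    rw [hP, aeval_rootPoly_eq_zero_iff h0] at h'
    obtain ⟨j, hj⟩ := h'
    exact ⟨j, hj.symm⟩)
  have key := (SpectralData.Represents.aeval_div (S := S) (P := P)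
    (Q := C S.c * P + ∑ j, C (S.b j) * rootCofactor S.ζ j) ⟨hP, rfl⟩ h0 hz')
  rw [← h z hz'] at key
  exact ((div_left_inj' hz').1 key).symm

/-- The sign conditions on spectral data. -/
structure SpectralData.Admissible {K : ℕ} (N : ℕ) (S : SpectralData K) : Prop where
  node_pos : ∀ j, 0 < S.ζ j
  node_strictMono : StrictMono S.ζ
  weight_pos : ∀ j, 0 < S.b j
  shift_pos_of_odd : Odd N → 0 < S.c
  shift_eq_zero_of_even : Even N → S.c = 0

lemma nodePoly_eq_rootPoly (a : ℕ → ℝ) (K : ℕ) :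
    nodePoly a K = rootPoly (fun i : Fin K => a (i + 1)) := by
  rw [nodePoly, rootPoly, Finset.prod_range]

/-- The weight `b_j` is `Q(ζ_j)` over the cofactor at `ζ_j`, and the two have the same alternating
sign. The shift `c` is the quotient of the coefficients in degree `N / 2`; for even `N` the degree
bound on `Q` makes it vanish. -/
lemma Interlacing.exists_represents {N : ℕ} {Q P : ℝ[X]} {a : ℕ → ℝ} (H : Interlacing N Q P a) :
    ∃ S : SpectralData (N / 2), S.Admissible N ∧ S.Represents Q P := by
  set ζ : Fin (N / 2) → ℝ := fun i => a (i + 1) with hζ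
  have hlt := fun {i j} => lt_of_forall_lt_succ (i := i) (j := j) H.lt_succ
  have hpos : ∀ i < N / 2, 0 < a (i + 1) := fun i hi => H.zero ▸ hlt (Nat.succ_pos i) hi
  have hζpos : ∀ i, 0 < ζ i := fun i => hpos i i.2
  have hmono : StrictMono ζ := fun i j hij => hlt (by simpa using hij) (by omega)
  have hP : P = rootPoly ζ := by rw [H.eq_nodePoly, nodePoly_eq_rootPoly]
  have hK : 0 < (-1 : ℝ) ^ (N / 2) * P.coeff (N / 2) := by
    rw [H.eq_nodePoly]; exact neg_one_pow_mul_coeff_nodePoly_pos hpos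
  -- With `Fin` indices starting at `0`, exactly `j` of the nodes lie below `ζ j`.
  have hcof : ∀ j : Fin (N / 2), 0 < (-1 : ℝ) ^ (j : ℕ) * (rootCofactor ζ j).eval (ζ j) := by
    intro j
    have := neg_one_pow_mul_prod_pos (j := (j : ℕ)) (a := a) (t := ζ j)
      (s := (Finset.range (N / 2)).erase j)
      (fun i hi => hpos i (Finset.mem_range.1 (Finset.mem_of_mem_erase hi))) (by
        have : ((Finset.range (N / 2)).erase (j : ℕ)).filter (· < (j : ℕ))
            = Finset.range (j : ℕ) := by
          ext i; have := j.2; simp only [Finset.mem_filter, Finset.mem_erase, Finset.mem_range]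
          omega
        rw [this, Finset.card_range])
      (fun i hi hij => hlt (by omega) j.2)
      (fun i hi hij => by
        have h1 := Finset.mem_erase.1 hi
        exact hlt (by omega) (Finset.mem_range.1 h1.2))
    have e : (rootCofactor ζ j).eval (ζ j) = (ζ j)⁻¹ *
        ∏ i ∈ (Finset.range (N / 2)).erase (j : ℕ), (1 - (a (i + 1))⁻¹ * ζ j) := by
      rw [rootCofactor, eval_mul, eval_C, eval_prod]
      congr 1
      refine Finset.prod_nbij (fun i : Fin (N / 2) => (i : ℕ)) ?_ ?_ ?_ ?_
      · intro i hi
        simp only [Finset.mem_erase, Finset.mem_range, Finset.mem_univ, and_true] at hi ⊢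
        exact ⟨fun h => hi (Fin.ext h), i.2⟩
      · exact fun i _ i' _ h => Fin.ext h
      · intro i hi
        simp only [Finset.coe_erase, Finset.coe_range, Set.mem_sdiff, Set.mem_Iio,
          Set.mem_singleton_iff] at hi
        exact ⟨⟨i, hi.1⟩, by simpa [Fin.ext_iff] using hi.2, rfl⟩
      · intro i _
        simp [hζ]
    rw [e, mul_left_comm]
    exact mul_pos (inv_pos.2 (hζpos j)) this
  have hcof0 : ∀ j : Fin (N / 2), (rootCofactor ζ j).eval (ζ j) ≠ 0 := fun j =>
    right_ne_zero_of_mul (hcof j).ne'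
  set c := Q.coeff (N / 2) / P.coeff (N / 2) with hc
  set b : Fin (N / 2) → ℝ := fun j => Q.eval (ζ j) / (rootCofactor ζ j).eval (ζ j) with hb
  refine ⟨⟨ζ, b, c⟩, ⟨hζpos, hmono, fun j => ?_, fun ho => ?_, fun he => ?_⟩, hP, ?_⟩
  · have h1 := H.alternating j j.2
    have : b j = ((-1 : ℝ) ^ (j : ℕ) * Q.eval (ζ j)) /
        ((-1 : ℝ) ^ (j : ℕ) * (rootCofactor ζ j).eval (ζ j)) := by
      rw [mul_div_mul_left _ _ (by simp)]
    show 0 < b j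
    rw [this]
    exact div_pos h1 (hcof j)
  · have : c = ((-1 : ℝ) ^ (N / 2) * Q.coeff (N / 2)) /
        ((-1 : ℝ) ^ (N / 2) * P.coeff (N / 2)) := by
      rw [mul_div_mul_left _ _ (by simp)]
    show 0 < c
    rw [this]
    exact div_pos (H.coeff_pos ho) hK
  · show c = 0
    rcases Nat.eq_zero_or_pos N with h | h
    · rw [hc, H.eq_zero h, coeff_zero, zero_div]
    · rw [hc, coeff_eq_zero_of_natDegree_lt (H.natDegree_le.trans_lt ?_), zero_div]
      obtain ⟨j, hj⟩ := he; omega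
  · show Q = C c * P + ∑ j, C (b j) * rootCofactor ζ j
    rw [← sub_eq_iff_eq_add']
    -- After the top coefficient is removed by `c`, both sides have degree below `N / 2` and need
    -- only be compared at the `N / 2` nodes.
    refine eq_of_degrees_lt_of_eval_index_eq (v := ζ) Finset.univ hmono.injective.injOn ?_ ?_ ?_
    · rw [Finset.card_univ, Fintype.card_fin]
      have hd : (Q - C c * P).natDegree ≤ N / 2 :=
        (natDegree_sub_le _ _).trans (max_le (H.natDegree_le.trans (by omega))
          ((natDegree_C_mul_le _ _).trans (hP ▸ natDegree_rootPoly_le ζ)))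
      rw [degree_lt_iff_coeff_zero]
      intro i hi
      rcases hi.eq_or_lt with h | h
      · rw [← h, coeff_sub, coeff_C_mul, hc, div_mul_cancel₀ _ (right_ne_zero_of_mul hK.ne'),
          sub_self]
      · exact coeff_eq_zero_of_natDegree_lt (hd.trans_lt h)
    · rw [Finset.card_univ, Fintype.card_fin, degree_lt_iff_coeff_zero]
      intro i hi
      rw [finsetSum_coeff]
      refine Finset.sum_eq_zero fun j _ => ?_
      rw [coeff_C_mul, coeff_eq_zero_of_natDegree_lt
        ((natDegree_rootCofactor_lt ζ j).trans_le hi), mul_zero]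
    · intro j _
      rw [eval_finsetSum, Finset.sum_eq_single j (fun i _ hij => by
        rw [eval_mul, eval_rootCofactor_of_ne hij.symm (hζpos j).ne', mul_zero])
        (fun h => absurd (Finset.mem_univ j) h), eval_mul, eval_C, eval_sub, eval_mul, hP,
        eval_rootPoly_self (hζpos j).ne', mul_zero, sub_zero, hb]
      exact (div_mul_cancel₀ _ (hcof0 j)).symm

section

variable {N : ℕ} {m n x : ℕ → ℝ} {Φ : ℂ → ℝ → ℂ × ℂ}

/-- This replaces the analytic characterization by the polynomial identity. The comparison data `T`
serve to show that `P` has exactly the prescribed nodes as simple zeros, which the spectrum as a set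
does not show. -/
lemma isSpectralData_iff_represents (hx : StrictMonoOn x (Set.Icc 1 N))
    (hΦ : ∀ z, IsNormalizedSolution N m n x z (Φ z)) (S : SpectralData (N / 2))
    (hP : ∃ T : SpectralData (N / 2), T.Admissible N ∧ T.Represents
      (transferPoly (hWeight m x) (gWeight n x) N).1
      (transferPoly (hWeight m x) (gWeight n x) N).2) :
    IsSpectralData N m n x Φ S ↔ S.Admissible N ∧
      S.Represents (transferPoly (hWeight m x) (gWeight n x) N).1
        (transferPoly (hWeight m x) (gWeight n x) N).2 := by
  set Q := (transferPoly (hWeight m x) (gWeight n x) N).1 with hQ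
  set P := (transferPoly (hWeight m x) (gWeight n x) N).2 with hPd
  have hlim : ∀ z, Tendsto (Φ z) atTop (𝓝 (aeval z Q, aeval z P)) := by
    intro z
    rw [(isNormalizedSolution_iff hx z _).1 (hΦ z)]
    have := systemSolution_tendsto_atTop N m n x z (0, 1)
    rwa [transferState_eq_aeval, one_mul, one_mul] at this
  have hint : ∀ S : SpectralData (N / 2), (∀ j, 0 < S.b j) → ∀ z : ℂ,
      (∫ s, 1 / ((s : ℂ) - z) ∂S.measure)
        = ∑ j, (S.b j : ℂ) * (1 / ((S.ζ j : ℂ) - z)) := by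
    intro S hS z
    rw [S.integral_measure (fun j => (hS j).le)]
    exact Finset.sum_congr rfl fun j _ => Complex.real_smul
  obtain ⟨T, hT, hTr⟩ := hP
  constructor
  · intro h
    have h0 : ∀ i, S.ζ i ≠ 0 := fun i => (h.node_pos i).ne'
    refine ⟨⟨h.1, h.2, h.3, h.4, h.5⟩, SpectralData.represents_of_aeval_div h0 ?_ ?_⟩
    · have hr : Set.range S.ζ = Set.range T.ζ := by
        ext t
        have h1 := h.spectrum_eq t
        rw [isEigenvalueBVP_iff hx, ← hPd, hTr.den,
          aeval_rootPoly_eq_zero_iff fun i => (hT.node_pos i).ne'] at h1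
        simp only [Complex.ofReal_inj] at h1
        simp only [Set.mem_range, eq_comm (b := t)]
        exact h1.symm
      rw [hTr.den, (h.node_strictMono.range_inj hT.node_strictMono).1 hr]
    · intro z hz
      obtain ⟨q, p, h1, h2, h3⟩ := h.weyl_eq z (by rwa [isEigenvalueBVP_iff hx])
      rw [hint S h.weight_pos] at h3
      obtain ⟨rfl, rfl⟩ := Prod.mk.inj (tendsto_nhds_unique h1 (hlim z))
      exact h3
  · rintro ⟨hS, hr⟩
    have h0 : ∀ i, S.ζ i ≠ 0 := fun i => (hS.node_pos i).ne'
    refine ⟨hS.1, hS.2, hS.3, hS.4, hS.5, fun z => ?_, fun z hz => ?_⟩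
    · rw [isEigenvalueBVP_iff hx, ← hPd, hr.den, aeval_rootPoly_eq_zero_iff h0]
    · rw [isEigenvalueBVP_iff hx] at hz
      refine ⟨_, _, hlim z, hz, ?_⟩
      rw [hint S hS.weight_pos, hr.aeval_div h0 hz]

lemma SpectralData.Represents.unique_of_admissible {K : ℕ} {S T : SpectralData K} {Q P : ℝ[X]}
    (hS : S.Represents Q P) (hSa : S.Admissible N) (hT : T.Represents Q P)
    (hTa : T.Admissible N) : S = T := by
  have h0 : ∀ i, S.ζ i ≠ 0 := fun i => (hSa.node_pos i).ne'
  refine hS.unique hT ?_ h0 hSa.node_strictMono.injective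
  refine (hSa.node_strictMono.range_inj hTa.node_strictMono).1 ?_
  ext t
  have h1 := aeval_rootPoly_eq_zero_iff h0 t
  rw [← hS.den, hT.den, aeval_rootPoly_eq_zero_iff fun i => (hTa.node_pos i).ne'] at h1
  simp only [Complex.ofReal_inj] at h1
  simp only [Set.mem_range, eq_comm (b := t)]
  exact h1.symm

lemma exists_represents (hm : ∀ j ∈ Set.Icc 1 N, 0 < m j) (hn : ∀ j ∈ Set.Icc 1 N, 0 < n j) :
    ∃ T : SpectralData (N / 2), T.Admissible N ∧ T.Represents
      (transferPoly (hWeight m x) (gWeight n x) N).1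
      (transferPoly (hWeight m x) (gWeight n x) N).2 := by
  obtain ⟨a, ha⟩ := exists_interlacing (h := hWeight m x) (g := gWeight n x)
    (fun j hj => mul_pos (hm j hj) (Real.exp_pos _))
    (fun j hj => mul_pos (hn j hj) (Real.exp_pos _))
  exact ha.exists_represents

end

end

/-! ### Hankel determinants and the sums over subsets. -/

/-- The determinant of the `l × l` Hankel matrix of the moments `M_p, …, M_{p+2l-2}`. -/
noncomputable def hankelDet (M : ℕ → ℝ) (l p : ℕ) : ℝ :=
  (Matrix.of fun i j : Fin l => M (p + i + j)).det

/-- Each row is a combination of the vectors `(v_k^j)_j`, so multilinearity in the rows expands the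
determinant over all choices `r` of one node per row. -/
lemma det_sum_eq_sum_functions {K l : ℕ} (w v : Fin K → ℝ) :
    (Matrix.of fun i j : Fin l => ∑ k, w k * v k ^ ((i : ℕ) + j)).det
      = ∑ r : Fin l → Fin K, (∏ i, w (r i) * v (r i) ^ (i : ℕ)) *
        (Matrix.vandermonde (v ∘ r)).det := by
  have e : (Matrix.of fun i j : Fin l => ∑ k, w k * v k ^ ((i : ℕ) + j))
      = fun i : Fin l => ∑ k, (w k * v k ^ (i : ℕ)) • (fun j : Fin l => v k ^ (j : ℕ)) := by
    ext i j
    rw [Matrix.of_apply, Finset.sum_apply]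
    refine Finset.sum_congr rfl fun k _ => ?_
    rw [Pi.smul_apply, smul_eq_mul, pow_add]; ring
  rw [e]
  change (Matrix.detRowAlternating (n := Fin l) (R := ℝ)).toMultilinearMap
    (fun i : Fin l => ∑ k, (w k * v k ^ (i : ℕ)) • (fun j : Fin l => v k ^ (j : ℕ))) = _
  rw [MultilinearMap.map_sum]
  refine Finset.sum_congr rfl fun r _ => ?_
  rw [MultilinearMap.map_smul_univ]
  rfl

lemma sum_injective_image_eq {K l : ℕ} (F : (Fin l → Fin K) → ℝ) (I : Finset (Fin K))
    (hI : I.card = l) :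
    ∑ r : Fin l → Fin K with Function.Injective r ∧ Finset.univ.image r = I, F r
      = ∑ σ : Equiv.Perm (Fin l), F (I.orderEmbOfFin hI ∘ σ) := by
  symm
  refine Finset.sum_nbij (fun σ => I.orderEmbOfFin hI ∘ σ) ?_ ?_ ?_ fun _ _ => rfl
  · intro σ _
    simp only [Finset.mem_filter, Finset.mem_univ, true_and]
    refine ⟨(I.orderEmbOfFin hI).injective.comp σ.injective, ?_⟩
    rw [← Finset.image_image, Finset.image_univ_equiv, Finset.image_orderEmbOfFin_univ]
  · intro σ _ τ _ h
    ext i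
    exact congrArg _ ((I.orderEmbOfFin hI).injective (congrFun h i))
  · intro r hr
    simp only [Finset.coe_filter, Finset.mem_univ, true_and, Set.mem_ofPred_eq] at hr
    have hmem : ∀ i, r i ∈ I := fun i => hr.2 ▸ Finset.mem_image_of_mem r (Finset.mem_univ i)
    have hex : ∀ i, ∃ j, I.orderEmbOfFin hI j = r i := fun i => by
      have := hmem i
      rw [← Finset.mem_coe, ← Finset.range_orderEmbOfFin I hI] at this
      exact this
    choose τ hτ using hex
    have hinj : Function.Injective τ := fun i j hij => hr.1 (by rw [← hτ, ← hτ, hij])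
    exact ⟨Equiv.ofBijective τ (Finite.injective_iff_bijective.1 hinj), by simp,
      funext fun i => hτ i⟩

/-- Permuting the nodes changes the Vandermonde determinant by the sign; what is left is the Leibniz
expansion of a second Vandermonde determinant. -/
lemma sum_perm_eq {l : ℕ} (w v : Fin l → ℝ) :
    ∑ σ : Equiv.Perm (Fin l), (∏ i, w (σ i) * v (σ i) ^ (i : ℕ)) *
        (Matrix.vandermonde (v ∘ σ)).det
      = (Matrix.vandermonde v).det ^ 2 * ∏ i, w i := by
  have h1 : ∀ σ : Equiv.Perm (Fin l), (∏ i, w (σ i) * v (σ i) ^ (i : ℕ)) *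
      (Matrix.vandermonde (v ∘ σ)).det = (∏ i, w i) * (Matrix.vandermonde v).det *
        ((Equiv.Perm.sign σ : ℤ) * ∏ i, Matrix.vandermonde v (σ i) i) := by
    intro σ
    have : Matrix.vandermonde (v ∘ σ) = (Matrix.vandermonde v).submatrix σ id := rfl
    rw [this, Matrix.det_permute, Finset.prod_mul_distrib, Equiv.prod_comp σ w]
    simp only [Matrix.vandermonde_apply]
    ring
  rw [Finset.sum_congr rfl fun σ _ => h1 σ, ← Finset.mul_sum, ← Matrix.det_apply']
  ring

lemma prod_lt_eq_det_vandermonde {K l : ℕ} (v : Fin K → ℝ) (I : Finset (Fin K))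
    (hI : I.card = l) :
    ∏ i ∈ I, ∏ j ∈ I with i < j, (v j - v i)
      = (Matrix.vandermonde (v ∘ I.orderEmbOfFin hI)).det := by
  rw [Matrix.det_vandermonde]
  have hm : I = Finset.univ.map (I.orderEmbOfFin hI).toEmbedding := by simp
  generalize I.orderEmbOfFin hI = u at hm
  subst hm
  rw [Finset.prod_map]
  refine Finset.prod_congr rfl fun i _ => ?_
  have : (Finset.univ.map u.toEmbedding).filter (u i < ·)
      = (Finset.Ioi i).map u.toEmbedding := by
    ext j; simp [Finset.mem_map]
    constructor
    · rintro ⟨⟨a, rfl⟩, h⟩; exact ⟨a, by simpa using h, rfl⟩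
    · rintro ⟨a, h, rfl⟩; exact ⟨⟨a, rfl⟩, by simpa using h⟩
  erw [this, Finset.prod_map]
  rfl

/-- The Heine formula for Hankel determinants of a discrete measure. -/
lemma det_hankel_eq_sum {K l : ℕ} (w v : Fin K → ℝ) :
    (Matrix.of fun i j : Fin l => ∑ k, w k * v k ^ ((i : ℕ) + j)).det
      = ∑ I ∈ Finset.powersetCard l (Finset.univ : Finset (Fin K)),
        (∏ i ∈ I, ∏ j ∈ I with i < j, (v j - v i)) ^ 2 * ∏ i ∈ I, w i := by
  rw [det_sum_eq_sum_functions]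
  -- Choices with a repeated node give equal rows; the injective ones are grouped by their image
  -- `I`.
  rw [← Finset.sum_filter_of_ne (p := Function.Injective)]
  · rw [← Finset.sum_fiberwise_of_maps_to (s := Finset.univ.filter Function.Injective)
      (t := Finset.powersetCard l Finset.univ) (g := fun r => Finset.univ.image r)]
    · refine Finset.sum_congr rfl fun I hI => ?_
      have hc := (Finset.mem_powersetCard.1 hI).2
      rw [Finset.filter_filter, sum_injective_image_eq _ I hc, prod_lt_eq_det_vandermonde v I hc]
      have hw : ∏ i ∈ I, w i = ∏ i, w (I.orderEmbOfFin hc i) := by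
        have hm : I = Finset.univ.map (I.orderEmbOfFin hc).toEmbedding := by simp
        nth_rewrite 1 [hm]
        rw [Finset.prod_map]
        rfl
      rw [hw]
      exact sum_perm_eq (w ∘ I.orderEmbOfFin hc) (v ∘ I.orderEmbOfFin hc)
    · intro r hr
      simp only [Finset.mem_filter, Finset.mem_univ, true_and] at hr
      rw [Finset.mem_powersetCard]
      exact ⟨Finset.subset_univ _, by rw [Finset.card_image_of_injective _ hr]; simp⟩
  · intro r _ hne i j hij
    by_contra hij'
    apply hne
    rw [Matrix.det_zero_of_row_eq hij', mul_zero]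
    ext k
    simp [Matrix.vandermonde_apply, hij]

/-- The `r`-th moment of the functional
`f ↦ ∫ f(s) dμ(s) / ∏_{i ≤ k} (e_i + s) + c [y^{k-1}] f`. -/
noncomputable def spectralMoment {K : ℕ} (e : ℕ → ℝ) (S : SpectralData K) (k r : ℕ) : ℝ :=
  ∑ j, S.b j / (∏ i ∈ Finset.Icc 1 k, (e i + S.ζ j)) * S.ζ j ^ r + if r + 1 = k then S.c else 0

lemma csvSum_eq_det {K : ℕ} (e : ℕ → ℝ) (S : SpectralData K) (k l p : ℕ) :
    csvSum e S k l p = hankelDet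
      (fun r => ∑ j, S.b j / (∏ i ∈ Finset.Icc 1 k, (e i + S.ζ j)) * S.ζ j ^ r) l p := by
  have h := det_hankel_eq_sum (l := l)
    (fun j => S.b j * S.ζ j ^ p / ∏ i ∈ Finset.Icc 1 k, (e i + S.ζ j)) S.ζ
  have e1 : (Matrix.of fun i j : Fin l =>
      ∑ k_1, S.b k_1 * S.ζ k_1 ^ p / (∏ i ∈ Finset.Icc 1 k, (e i + S.ζ k_1)) *
        S.ζ k_1 ^ ((i : ℕ) + j)).det = hankelDet
      (fun r => ∑ j, S.b j / (∏ i ∈ Finset.Icc 1 k, (e i + S.ζ j)) * S.ζ j ^ r) l p := by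
    rw [hankelDet]
    congr 1
    ext i j
    simp only [Matrix.of_apply]
    refine Finset.sum_congr rfl fun q _ => ?_
    rw [add_assoc, pow_add (S.ζ q) p]
    ring
  rw [← e1, h, csvSum]
  refine Finset.sum_congr rfl fun I _ => ?_
  rw [Finset.prod_div_distrib, Finset.prod_comm (s := Finset.Icc 1 k), mul_div_assoc]

/-- The index `p + 2 * l` occurs only in the lower right corner, whose cofactor is the Hankel
determinant of one size less. -/
lemma hankelDet_add_last (M : ℕ → ℝ) (c : ℝ) (l p : ℕ) :
    hankelDet (fun r => M r + if r = p + 2 * l then c else 0) (l + 1) p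
      = hankelDet M (l + 1) p + c * hankelDet M l p := by
  set A : Matrix (Fin (l + 1)) (Fin (l + 1)) ℝ := Matrix.of fun i j => M (p + i + j) with hA
  have e1 : (Matrix.of fun i j : Fin (l + 1) =>
      (fun r => M r + if r = p + 2 * l then c else 0) (p + i + j))
      = A.updateRow (Fin.last l) (A (Fin.last l) + c • Pi.single (Fin.last l) 1) := by
    ext i j
    rw [Matrix.updateRow_apply]
    have hi := i.2
    have hj := j.2
    by_cases h : i = Fin.last l
    · subst h
      by_cases h' : j = Fin.last l
      · subst h'
        simp [hA, show p + l + l = p + 2 * l by ring]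
      · have : (j : ℕ) ≠ l := fun h => h' (Fin.ext h)
        simp [hA, h', show p + l + (j : ℕ) ≠ p + 2 * l by omega]
    · have : (i : ℕ) ≠ l := fun h' => h (Fin.ext h')
      simp [hA, h, show p + (i : ℕ) + (j : ℕ) ≠ p + 2 * l by omega]
  rw [hankelDet, e1, Matrix.det_updateRow_add, Matrix.updateRow_eq_self, Matrix.det_updateRow_smul,
    hankelDet, ← hA]
  congr 2
  rw [← Matrix.adjugate_apply, Matrix.adjugate_fin_succ_eq_det_submatrix, hankelDet]
  have : (-1 : ℝ) ^ (((Fin.last l : Fin (l + 1)) : ℕ) + ((Fin.last l : Fin (l + 1)) : ℕ)) = 1 := by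
    rw [← two_mul, pow_mul]; simp
  rw [this, one_mul]
  congr 1
  ext i j
  simp [hA]

lemma hankelDet_congr {M M' : ℕ → ℝ} {l p : ℕ} (h : ∀ r, r + 2 ≤ p + 2 * l → M r = M' r) :
    hankelDet M l p = hankelDet M' l p := by
  rw [hankelDet, hankelDet]
  congr 1
  ext i j
  exact h _ (by have := i.2; have := j.2; omega)

/-- The largest moment index is `p + 2 * l - 2 ≤ k - 1`. So the moment carrying `c` appears at most
in the corner, and it does so exactly when `p + 2 * l = k + 1`: this is the extra term of
`csvReduced`. -/
lemma csvReduced_eq_hankelDet {K : ℕ} (e : ℕ → ℝ) (S : SpectralData K) {k l p : ℕ}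
    (h : p + 2 * l ≤ k + 1) :
    csvReduced e S k l p = hankelDet (spectralMoment e S k) l p := by
  rw [csvReduced, csvSum_eq_det]
  cases l with
  | zero => simp [hankelDet]
  | succ l =>
    by_cases hk : p + 2 * (l + 1) = k + 1
    · rw [if_pos ⟨by omega, hk⟩, Nat.add_sub_cancel, csvSum_eq_det, ← hankelDet_add_last]
      refine hankelDet_congr fun r hr => ?_
      rw [spectralMoment]
      simp only [show r = p + 2 * l ↔ r + 1 = k by omega]
    · rw [if_neg (fun h => hk h.2), add_zero]
      refine hankelDet_congr fun r hr => ?_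
      rw [spectralMoment, if_neg (by omega), add_zero]

/-! ### Positivity of the reduced determinants. -/

lemma csvSum_nonneg {K : ℕ} {e : ℕ → ℝ} {S : SpectralData K} {k : ℕ} (l p : ℕ)
    (he : ∀ i ∈ Finset.Icc 1 k, 0 < e i) (hζ : ∀ j, 0 < S.ζ j) (hb : ∀ j, 0 < S.b j) :
    0 ≤ csvSum e S k l p :=
  Finset.sum_nonneg fun _ _ => div_nonneg
    (mul_nonneg (sq_nonneg _) (Finset.prod_nonneg fun i _ =>
      mul_nonneg (hb i).le (pow_nonneg (hζ i).le _)))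
    (Finset.prod_nonneg fun r hr => Finset.prod_nonneg fun i _ =>
      (add_pos (he r hr) (hζ i)).le)

lemma csvSum_pos {K : ℕ} {e : ℕ → ℝ} {S : SpectralData K} {k l : ℕ} (p : ℕ) (hl : l ≤ K)
    (he : ∀ i ∈ Finset.Icc 1 k, 0 < e i) (hζ : ∀ j, 0 < S.ζ j) (hmono : StrictMono S.ζ)
    (hb : ∀ j, 0 < S.b j) : 0 < csvSum e S k l p := by
  refine Finset.sum_pos (fun _ _ => div_pos (mul_pos (pow_pos ?_ 2)
    (Finset.prod_pos fun i _ => mul_pos (hb i) (pow_pos (hζ i) _)))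
    (Finset.prod_pos fun r hr => Finset.prod_pos fun i _ => add_pos (he r hr) (hζ i))) ?_
  · refine Finset.prod_pos fun i _ => Finset.prod_pos fun j hj => ?_
    exact sub_pos.2 (hmono (Finset.mem_filter.1 hj).2)
  · rw [Finset.powersetCard_nonempty]
    simpa using hl

lemma SpectralData.Admissible.shift_nonneg {K N : ℕ} {S : SpectralData K} (hS : S.Admissible N) :
    0 ≤ S.c := by
  rcases Nat.even_or_odd N with h | h
  · exact (hS.shift_eq_zero_of_even h).ge
  · exact (hS.shift_pos_of_odd h).le

lemma csvReduced_nonneg {K N : ℕ} {e : ℕ → ℝ} {S : SpectralData K} {k : ℕ} (l p : ℕ)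
    (he : ∀ i ∈ Finset.Icc 1 k, 0 < e i) (hS : S.Admissible N) :
    0 ≤ csvReduced e S k l p := by
  refine add_nonneg (csvSum_nonneg l p he hS.node_pos hS.weight_pos) ?_
  split_ifs
  · exact mul_nonneg hS.shift_nonneg (csvSum_nonneg _ p he hS.node_pos hS.weight_pos)
  · exact le_rfl

lemma csvReduced_pos {K N : ℕ} {e : ℕ → ℝ} {S : SpectralData K} {k l : ℕ} (p : ℕ) (hl : l ≤ K)
    (he : ∀ i ∈ Finset.Icc 1 k, 0 < e i) (hS : S.Admissible N) :
    0 < csvReduced e S k l p := by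
  refine add_pos_of_pos_of_nonneg
    (csvSum_pos p hl he hS.node_pos hS.node_strictMono hS.weight_pos) ?_
  split_ifs
  · exact mul_nonneg hS.shift_nonneg (csvSum_nonneg _ p he hS.node_pos hS.weight_pos)
  · exact le_rfl

/-- This covers the size `K + 1`, where the sum over subsets is empty and only the term with `c` is
left. -/
lemma csvReduced_pos_of_odd {K N : ℕ} {e : ℕ → ℝ} {S : SpectralData K} {k l p : ℕ}
    (hN : Odd N) (hl : l ≤ K) (hk : p + 2 * (l + 1) = k + 1)
    (he : ∀ i ∈ Finset.Icc 1 k, 0 < e i) (hS : S.Admissible N) :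
    0 < csvReduced e S k (l + 1) p := by
  refine add_pos_of_nonneg_of_pos (csvSum_nonneg _ p he hS.node_pos hS.weight_pos) ?_
  rw [if_pos ⟨by omega, hk⟩, Nat.add_sub_cancel]
  exact mul_pos (hS.shift_pos_of_odd hN)
    (csvSum_pos p hl he hS.node_pos hS.node_strictMono hS.weight_pos)

/-! ### CSV determinants through divided differences. -/

/-- The divided difference at `k` points reads off the coefficient of degree `k - 1`. -/
lemma sum_nodalWeight_mul_pow {k : ℕ} {y : Fin k → ℝ} (hy : Function.Injective y) {r : ℕ}
    (hr : r + 1 ≤ k) :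
    ∑ i, Lagrange.nodalWeight Finset.univ y i * y i ^ r = if r + 1 = k then 1 else 0 := by
  have h := Lagrange.coeff_eq_sum (s := Finset.univ) (v := y) hy.injOn
    (P := Polynomial.X ^ r) (by
      rw [Polynomial.degree_X_pow, Finset.card_univ, Fintype.card_fin]
      exact_mod_cast hr)
  rw [Finset.card_univ, Fintype.card_fin, Polynomial.coeff_X_pow] at h
  have e : (k - 1 = r) ↔ r + 1 = k := by omega
  simp only [e] at h
  rw [h]
  refine Finset.sum_congr rfl fun i _ => ?_
  rw [Lagrange.nodalWeight, Finset.prod_inv_distrib, Polynomial.eval_pow, Polynomial.eval_X]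
  exact inv_mul_eq_div _ _

/-- Since `y^r` is its own interpolant, the barycentric formula at the point `-s` gives this value.
-/
lemma sum_nodalWeight_mul_pow_div {k : ℕ} {y : Fin k → ℝ} (hy : Function.Injective y) {r : ℕ}
    (hr : r + 1 ≤ k) {s : ℝ} (hs : ∀ i, 0 < y i + s) :
    ∑ i, Lagrange.nodalWeight Finset.univ y i * (y i ^ r * (1 / (y i + s)))
      = (-1) ^ (k + 1 + r) * (s ^ r / ∏ i, (y i + s)) := by
  have hne : ∀ i ∈ (Finset.univ : Finset (Fin k)), -s ≠ y i := fun i _ h => by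
    have := hs i; linarith
  have h := Lagrange.eval_interpolate_not_at_node (fun i => y i ^ r) hne
  have hX : Lagrange.interpolate Finset.univ y (fun i => y i ^ r) = Polynomial.X ^ r := by
    rw [Lagrange.eq_interpolate hy.injOn (f := Polynomial.X ^ r) (by
      rw [Polynomial.degree_X_pow, Finset.card_univ, Fintype.card_fin]
      exact_mod_cast hr)]
    simp
  rw [hX, Polynomial.eval_pow, Polynomial.eval_X, Lagrange.eval_nodal] at h
  have e1 : ∏ i, (-s - y i) = (-1) ^ k * ∏ i, (y i + s) := by
    have h1 : (-1 : ℝ) ^ k = ∏ _i : Fin k, (-1 : ℝ) := by simp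
    rw [h1, ← Finset.prod_mul_distrib]
    exact Finset.prod_congr rfl fun i _ => by ring
  have e2 : ∑ i, Lagrange.nodalWeight Finset.univ y i * (-s - y i)⁻¹ * y i ^ r
      = -∑ i, Lagrange.nodalWeight Finset.univ y i * (y i ^ r * (1 / (y i + s))) := by
    rw [← Finset.sum_neg_distrib]
    refine Finset.sum_congr rfl fun i _ => ?_
    rw [show -s - y i = -(y i + s) by ring, inv_neg, one_div]; ring
  rw [e1, e2, neg_pow s] at h
  have hp : (∏ i, (y i + s)) ≠ 0 := (Finset.prod_pos fun i _ => hs i).ne'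
  have hk : ((-1 : ℝ) ^ k) * (-1) ^ k = 1 := by rw [← mul_pow]; simp
  rw [← mul_div_assoc, eq_div_iff hp, pow_add, pow_succ]
  linear_combination (-1) ^ k * h - (∏ i, (y i + s)) *
    (∑ i, Lagrange.nodalWeight Finset.univ y i * (y i ^ r * (1 / (y i + s)))) * hk

/-- Reversing the columns gives a lower triangular matrix with unit diagonal. -/
lemma abs_det_eq_one_of_antitriangular {t : ℕ} (A : Matrix (Fin t) (Fin t) ℝ)
    (h0 : ∀ i j : Fin t, (i : ℕ) + j + 1 < t → A i j = 0)
    (h1 : ∀ i j : Fin t, (i : ℕ) + j + 1 = t → A i j = 1) : |A.det| = 1 := by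
  rw [← Matrix.abs_det_submatrix_equiv_equiv (Equiv.refl _) Fin.revPerm A,
    Matrix.det_of_isLowerTriangular]
  · rw [Finset.prod_eq_one, abs_one]
    intro i _
    refine h1 _ _ ?_
    simp only [Equiv.refl_apply, Fin.revPerm_apply, Fin.val_rev]
    omega
  · intro i j hij
    have : i < j := hij
    refine h0 _ _ ?_
    simp only [Equiv.refl_apply, Fin.revPerm_apply, Fin.val_rev]
    omega

lemma abs_det_sign_mul {l a : ℕ} (A : Matrix (Fin l) (Fin l) ℝ) :
    |(Matrix.of fun i j : Fin l => (-1 : ℝ) ^ (a + i + j) * A i j).det| = |A.det| := by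
  have e : (Matrix.of fun i j : Fin l => (-1 : ℝ) ^ (a + i + j) * A i j)
      = Matrix.of fun i j : Fin l => (-1 : ℝ) ^ (a + (i : ℕ)) *
        (Matrix.of fun i j : Fin l => (-1 : ℝ) ^ (j : ℕ) * A i j) i j := by
    ext i j
    simp only [Matrix.of_apply, pow_add]; ring
  rw [e, Matrix.det_mul_column, Matrix.det_mul_row, abs_mul, abs_mul, Finset.abs_prod,
    Finset.abs_prod]
  simp

lemma stieltjesTransform_eq {K : ℕ} (S : SpectralData K) (hb : ∀ j, 0 < S.b j) (t : ℝ) :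
    stieltjesTransform S.measure S.c t = S.c + ∑ j, S.b j * (1 / (t + S.ζ j)) := by
  rw [stieltjesTransform, S.integral_measure fun j => (hb j).le]
  rfl

/-- Divided differences turn the Stieltjes transform into the moments with denominators `∏ (y_i +
ζ_j)`; the constant `c` contributes only through `y^{k-1}`. This is the origin of the definition of
`spectralMoment`. -/
lemma sum_nodalWeight_mul_stieltjesTransform {k K : ℕ} {y : Fin k → ℝ}
    (hy : Function.Injective y) (hpos : ∀ i, 0 < y i) {S : SpectralData K}
    (hζ : ∀ j, 0 < S.ζ j) (hb : ∀ j, 0 < S.b j) {r : ℕ} (hr : r + 1 ≤ k) :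
    ∑ i, Lagrange.nodalWeight Finset.univ y i *
        (y i ^ r * stieltjesTransform S.measure S.c (y i))
      = (-1) ^ (k + 1 + r) * (∑ j, S.b j / (∏ i, (y i + S.ζ j)) * S.ζ j ^ r +
          if r + 1 = k then S.c else 0) := by
  have h1 : ∀ i, Lagrange.nodalWeight Finset.univ y i *
      (y i ^ r * stieltjesTransform S.measure S.c (y i))
      = S.c * (Lagrange.nodalWeight Finset.univ y i * y i ^ r) + ∑ j, S.b j *
        (Lagrange.nodalWeight Finset.univ y i * (y i ^ r * (1 / (y i + S.ζ j)))) := by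
    intro i
    rw [stieltjesTransform_eq S hb, mul_add, mul_add, Finset.mul_sum, Finset.mul_sum]
    congr 1
    · ring
    · exact Finset.sum_congr rfl fun j _ => by ring
  rw [Finset.sum_congr rfl fun i _ => h1 i, Finset.sum_add_distrib, ← Finset.mul_sum,
    sum_nodalWeight_mul_pow hy hr, Finset.sum_comm, mul_add, add_comm, Finset.mul_sum]
  congr 1
  · refine Finset.sum_congr rfl fun j _ => ?_
    rw [← Finset.mul_sum, sum_nodalWeight_mul_pow_div hy hr fun i => add_pos (hpos i) (hζ j)]
    ring
  · split_ifs with h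
    · subst h
      have : (-1 : ℝ) ^ (r + 1 + 1 + r) = 1 := Even.neg_one_pow ⟨r + 1, by ring⟩
      rw [this]; ring
    · simp

/-- The matrix whose rows are the divided difference functionals `f ↦ (y^r f)[y_1, …, y_k]`. -/
noncomputable def dividedDifferenceMatrix {k : ℕ} (y : Fin k → ℝ) : Matrix (Fin k) (Fin k) ℝ :=
  Matrix.of fun r i => Lagrange.nodalWeight Finset.univ y i * y i ^ (r : ℕ)

lemma abs_det_dividedDifference_mul_CSV {K l t p : ℕ} {y : Fin (l + t) → ℝ}
    (hy : Function.Injective y) (hpos : ∀ i, 0 < y i) {S : SpectralData K}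
    (hζ : ∀ j, 0 < S.ζ j) (hb : ∀ j, 0 < S.b j) (hp : p + l ≤ t + 1) :
    |(dividedDifferenceMatrix y * CSV (l + t) l p y S.measure S.c).det|
      = |hankelDet (fun r => ∑ j, S.b j / (∏ i, (y i + S.ζ j)) * S.ζ j ^ r +
          if r + 1 = l + t then S.c else 0) l p| := by
  set B := dividedDifferenceMatrix y * CSV (l + t) l p y S.measure S.c with hB
  have hB1 : ∀ r j : Fin (l + t), (j : ℕ) < l → B r j =
      ∑ i, Lagrange.nodalWeight Finset.univ y i *
        (y i ^ (p + r + j) * stieltjesTransform S.measure S.c (y i)) := by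
    intro r j hj
    rw [hB, Matrix.mul_apply]
    refine Finset.sum_congr rfl fun i _ => ?_
    rw [CSV, dividedDifferenceMatrix, Matrix.of_apply, Matrix.of_apply, if_pos hj,
      show p + (r : ℕ) + j = r + (p + j) by ring, pow_add]
    ring
  have hB2 : ∀ r j : Fin (l + t), ¬ (j : ℕ) < l → B r j =
      ∑ i, Lagrange.nodalWeight Finset.univ y i * y i ^ ((r : ℕ) + (j - l)) := by
    intro r j hj
    rw [hB, Matrix.mul_apply]
    refine Finset.sum_congr rfl fun i _ => ?_
    rw [CSV, dividedDifferenceMatrix, Matrix.of_apply, Matrix.of_apply, if_neg hj, pow_add]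
    ring
  rw [← Matrix.abs_det_submatrix_equiv_equiv finSumFinEquiv finSumFinEquiv B,
    ← Matrix.fromBlocks_toBlocks (B.submatrix finSumFinEquiv finSumFinEquiv)]
  -- In this block the exponents are at most `(l - 1) + (t - 1)`, below the critical `l + t - 1`.
  have h12 : (B.submatrix finSumFinEquiv finSumFinEquiv).toBlocks₁₂ = 0 := by
    ext i j
    have hi := i.2
    have hj := j.2
    simp only [Matrix.toBlocks₁₂, Matrix.of_apply, Matrix.submatrix_apply,
      finSumFinEquiv_apply_left, finSumFinEquiv_apply_right, Matrix.zero_apply]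
    rw [hB2 _ _ (by simp), sum_nodalWeight_mul_pow hy (by simp; omega), if_neg (by simp; omega)]
  rw [h12, Matrix.det_fromBlocks_zero₁₂, abs_mul]
  -- The lower right block is antitriangular with unit antidiagonal; the upper left one is the
  -- Hankel matrix up to checkerboard signs.
  rw [abs_det_eq_one_of_antitriangular (B.submatrix finSumFinEquiv finSumFinEquiv).toBlocks₂₂,
    mul_one, hankelDet, ← abs_det_sign_mul (a := l + t + 1 + p)]
  · congr 2
    ext i j
    have hi := i.2
    have hj := j.2
    simp only [Matrix.toBlocks₁₁, Matrix.of_apply, Matrix.submatrix_apply,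
      finSumFinEquiv_apply_left]
    rw [hB1 _ _ (by simp), Fin.val_castAdd, Fin.val_castAdd,
      sum_nodalWeight_mul_stieltjesTransform hy hpos hζ hb (by omega)]
    rw [show l + t + 1 + (p + (i : ℕ) + j) = l + t + 1 + p + i + j by ring,
      ← mul_assoc, ← mul_pow, neg_one_mul, neg_neg, one_pow, one_mul]
  · intro i j hij
    simp only [Matrix.toBlocks₂₂, Matrix.of_apply, Matrix.submatrix_apply,
      finSumFinEquiv_apply_right]
    rw [hB2 _ _ (by simp), sum_nodalWeight_mul_pow hy (by simp; omega), if_neg (by simp; omega)]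
  · intro i j hij
    simp only [Matrix.toBlocks₂₂, Matrix.of_apply, Matrix.submatrix_apply,
      finSumFinEquiv_apply_right]
    rw [hB2 _ _ (by simp), sum_nodalWeight_mul_pow hy (by simp; omega), if_pos (by simp; omega)]

lemma abs_det_CSV_eq {K k l p : ℕ} {y : Fin k → ℝ} (hpos : ∀ i, 0 < y i)
    {S : SpectralData K} (hζ : ∀ j, 0 < S.ζ j) (hb : ∀ j, 0 < S.b j) (hl : l ≤ k)
    (hp : p + 2 * l ≤ k + 1) :
    |(CSV k l p y S.measure S.c).det| = |(Matrix.vandermonde y).det| *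
      |hankelDet (fun r => ∑ j, S.b j / (∏ i, (y i + S.ζ j)) * S.ζ j ^ r +
          if r + 1 = k then S.c else 0) l p| := by
  by_cases hy : Function.Injective y
  · have h0 := abs_det_dividedDifference_mul_CSV (l := 0) (t := k) (p := 0)
      (y := y ∘ Fin.cast (Nat.zero_add k)) (hy.comp (Fin.cast_injective _)) (fun i => hpos _)
      hζ hb (by omega)
    obtain ⟨t, rfl⟩ := Nat.exists_eq_add_of_le hl
    have h1 := abs_det_dividedDifference_mul_CSV (l := l) (t := t) (p := p) hy hpos hζ hb
      (by omega)
    -- Thus the divided difference matrix has determinant `1 / |Δ(y)|` in absolute value.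
    have hV : |(dividedDifferenceMatrix y * Matrix.vandermonde y).det| = 1 := by
      refine abs_det_eq_one_of_antitriangular _ ?_ ?_
      · intro i j hij
        have : (dividedDifferenceMatrix y * Matrix.vandermonde y) i j =
            ∑ q, Lagrange.nodalWeight Finset.univ y q * y q ^ ((i : ℕ) + j) := by
          rw [Matrix.mul_apply]
          refine Finset.sum_congr rfl fun q _ => ?_
          rw [dividedDifferenceMatrix, Matrix.of_apply, Matrix.vandermonde_apply, pow_add]; ring
        rw [this, sum_nodalWeight_mul_pow hy hij.le, if_neg hij.ne]
      · intro i j hij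
        have : (dividedDifferenceMatrix y * Matrix.vandermonde y) i j =
            ∑ q, Lagrange.nodalWeight Finset.univ y q * y q ^ ((i : ℕ) + j) := by
          rw [Matrix.mul_apply]
          refine Finset.sum_congr rfl fun q _ => ?_
          rw [dividedDifferenceMatrix, Matrix.of_apply, Matrix.vandermonde_apply, pow_add]; ring
        rw [this, sum_nodalWeight_mul_pow hy hij.le, if_pos hij]
    rw [Matrix.det_mul, abs_mul] at h1 hV
    rw [← h1, ← mul_assoc, mul_comm |(Matrix.vandermonde y).det|, hV, one_mul]
  -- With coinciding points both the CSV and the Vandermonde matrix have two equal rows.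
  · obtain ⟨i, j, hij, hne⟩ : ∃ i j, y i = y j ∧ i ≠ j := by
      simpa [Function.Injective] using hy
    have hc : (CSV k l p y S.measure S.c).det = 0 :=
      Matrix.det_zero_of_row_eq hne (by ext q; simp [CSV, hij])
    have hv : (Matrix.vandermonde y).det = 0 :=
      Matrix.det_zero_of_row_eq hne (by ext q; simp [Matrix.vandermonde_apply, hij])
    rw [hc, hv, abs_zero, zero_mul]

lemma vandermondeE_eq_det (e : ℕ → ℝ) (k : ℕ) :
    vandermondeE e k = (Matrix.vandermonde fun i : Fin k => e (i + 1)).det := by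
  rw [Matrix.det_vandermonde, vandermondeE]
  symm
  refine Finset.prod_nbij (fun i : Fin k => (i : ℕ) + 1) ?_ ?_ ?_ ?_
  · exact fun i _ => Finset.mem_Icc.2 ⟨by omega, by omega⟩
  · exact fun i _ j _ h => Fin.ext (Nat.succ_injective h)
  · intro i hi
    obtain ⟨h1, h2⟩ := Finset.mem_Icc.1 (Finset.mem_coe.1 hi)
    exact ⟨⟨i - 1, by omega⟩, by simp, by simp; omega⟩
  · intro i _
    refine Finset.prod_nbij (fun j : Fin k => (j : ℕ) + 1) ?_ ?_ ?_ fun _ _ => rfl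
    · intro j hj
      have : i < j := Finset.mem_Ioi.1 hj
      exact Finset.mem_Ioc.2 ⟨by omega, by omega⟩
    · exact fun i _ j _ h => Fin.ext (Nat.succ_injective h)
    · intro j hj
      obtain ⟨h1, h2⟩ := Finset.mem_Ioc.1 (Finset.mem_coe.1 hj)
      refine ⟨⟨j - 1, by omega⟩, ?_, by simp; omega⟩
      simp only [Finset.coe_Ioi, Set.mem_Ioi, Fin.lt_def]
      omega

lemma csvD_eq {K N : ℕ} {e : ℕ → ℝ} {S : SpectralData K} {k l p : ℕ}
    (he : ∀ i ∈ Finset.Icc 1 k, 0 < e i) (hS : S.Admissible N) (hl : l ≤ k)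
    (hp : p + 2 * l ≤ k + 1) :
    csvD e S k l p = |vandermondeE e k| * csvReduced e S k l p := by
  have h := abs_det_CSV_eq (y := fun i : Fin k => e (i + 1))
    (fun i => he _ (Finset.mem_Icc.2 ⟨by omega, by omega⟩)) hS.node_pos hS.weight_pos hl hp
  have hprod : ∀ s, ∏ i : Fin k, (e (i + 1) + s) = ∏ i ∈ Finset.Icc 1 k, (e i + s) := by
    intro s
    rw [← Finset.prod_range fun i => e (i + 1) + s, Finset.range_eq_Ico,
      Finset.prod_Ico_add' (fun i => e i + s) 0 k 1]
    rfl
  simp only [hprod] at h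
  rw [csvD, h, vandermondeE_eq_det, ← abs_of_nonneg (csvReduced_nonneg l p he hS),
    csvReduced_eq_hankelDet e S hp]
  rfl

/-! ### Cramer's rule for bordered Hankel systems. -/

section

/-- Cramer's rule in adjugate form, which needs no invertibility of `A`. -/
lemma det_mul_eq_of_mulVec_eq_single {n : ℕ} {A : Matrix (Fin n) (Fin n) ℝ} {v : Fin n → ℝ}
    {r : Fin n} {s : ℝ} (h : A.mulVec v = Pi.single r s) (i : Fin n) :
    A.det * v i = s * A.adjugate i r := by
  have h1 := congrArg (fun u => A.adjugate.mulVec u i) h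
  simp only [Matrix.mulVec_mulVec, Matrix.adjugate_mul, Matrix.smul_mulVec, Matrix.one_mulVec,
    Matrix.mulVec_single] at h1
  simpa [mul_comm] using h1

section Cramer

variable {M a : ℕ → ℝ} {d : ℕ} {s t : ℝ}

lemma adjugate_last_last {A : Matrix (Fin (d + 1)) (Fin (d + 1)) ℝ}
    (hA : ∀ i j : Fin d, A i.castSucc j.castSucc = M (i + j)) :
    A.adjugate (Fin.last d) (Fin.last d) = hankelDet M d 0 := by
  rw [Matrix.adjugate_fin_succ_eq_det_submatrix, hankelDet, ← two_mul, pow_mul]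
  simp only [even_two, Even.neg_pow, one_pow, one_mul, Fin.succAbove_last]
  congr 1
  ext i j
  simp [hA]

lemma adjugate_zero_last {A : Matrix (Fin (d + 1)) (Fin (d + 1)) ℝ}
    (hA : ∀ i j : Fin d, A i.castSucc j.succ = M (1 + i + j)) :
    A.adjugate 0 (Fin.last d) = (-1) ^ d * hankelDet M d 1 := by
  rw [Matrix.adjugate_fin_succ_eq_det_submatrix, hankelDet]
  simp only [Fin.val_last, Fin.val_zero, add_zero, Fin.succAbove_last]
  congr 2
  ext i j
  simp [hA]

lemma adjugate_last_zero {A : Matrix (Fin (d + 1)) (Fin (d + 1)) ℝ}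
    (hA : ∀ i j : Fin d, A i.succ j.castSucc = M (1 + i + j)) :
    A.adjugate (Fin.last d) 0 = (-1) ^ d * hankelDet M d 1 := by
  rw [Matrix.adjugate_fin_succ_eq_det_submatrix, hankelDet]
  simp only [Fin.val_last, Fin.val_zero, zero_add, Fin.succAbove_last]
  congr 2
  ext i j
  simp [hA]

/-- The kernel of a `d × (d + 1)` Hankel matrix. -/
lemma hankel_kernel (h : ∀ i < d, ∑ q ∈ Finset.range (d + 1), a q * M (i + q) = 0) :
    (-1) ^ d * hankelDet M d 1 * a d = a 0 * hankelDet M d 0 := by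
  -- The system is completed to a square one by a last row that reads off `a 0`.
  set A : Matrix (Fin (d + 1)) (Fin (d + 1)) ℝ := Matrix.of fun i j =>
    if i = Fin.last d then (if j = 0 then 1 else 0) else M (i + j) with hA
  have hdet : A.det = (-1) ^ d * hankelDet M d 1 := by
    have h1 := congrFun (congrFun (Matrix.mul_adjugate A) (Fin.last d)) (Fin.last d)
    rw [Matrix.mul_apply, Finset.sum_eq_single 0 (fun j _ hj => by simp [hA, hj])
      (fun h => absurd (Finset.mem_univ _) h), adjugate_zero_last (M := M)] at h1
    · simpa [hA] using h1.symm
    · intro i j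
      simp only [hA, Matrix.of_apply, if_neg (Fin.castSucc_lt_last i).ne, Fin.val_castSucc,
        Fin.val_succ]
      congr 1; ring
  have hv : A.mulVec (fun j : Fin (d + 1) => a j) = Pi.single (Fin.last d) (a 0) := by
    ext i
    rw [Matrix.mulVec, dotProduct]
    by_cases hi : i = Fin.last d
    · subst hi
      rw [Finset.sum_eq_single 0 (fun j _ hj => by simp [hA, hj])
        (fun h => absurd (Finset.mem_univ _) h)]
      simp [hA]
    · rw [Pi.single_eq_of_ne hi, ← h i (Fin.val_lt_last hi), Finset.sum_range]
      refine Finset.sum_congr rfl fun j _ => ?_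
      simp [hA, hi, mul_comm]
  have key := det_mul_eq_of_mulVec_eq_single hv (Fin.last d)
  rw [hdet, adjugate_last_last (M := M)] at key
  · exact key
  · intro i j
    simp [hA, (Fin.castSucc_lt_last i).ne]

lemma hankel_solve_first (h0 : ∑ q ∈ Finset.range (d + 1), a q * M q = t)
    (h : ∀ i, 1 ≤ i → i ≤ d → ∑ q ∈ Finset.range (d + 1), a q * M (i + q) = 0) :
    hankelDet M (d + 1) 0 * a d = t * ((-1) ^ d * hankelDet M d 1) := by
  have hv : (Matrix.of fun i j : Fin (d + 1) => M (0 + i + j)).mulVec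
      (fun j : Fin (d + 1) => a j) = Pi.single 0 t := by
    ext i
    rw [Matrix.mulVec, dotProduct]
    by_cases hi : i = 0
    · subst hi
      rw [Pi.single_eq_same, ← h0, Finset.sum_range]
      refine Finset.sum_congr rfl fun j _ => ?_
      simp [mul_comm]
    · rw [Pi.single_eq_of_ne hi, ← h i (Nat.one_le_iff_ne_zero.2 fun h' => hi (Fin.ext h'))
        (by omega), Finset.sum_range]
      refine Finset.sum_congr rfl fun j _ => ?_
      simp [mul_comm]
  have key := det_mul_eq_of_mulVec_eq_single hv (Fin.last d)
  rw [adjugate_last_zero (M := M)] at key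
  · exact key
  · intro i j
    simp [add_comm]

lemma hankel_solve_last (h0 : ∑ q ∈ Finset.range (d + 1), a q * M (d + q) = s)
    (h : ∀ i < d, ∑ q ∈ Finset.range (d + 1), a q * M (i + q) = 0) :
    hankelDet M (d + 1) 0 * a 0 = s * ((-1) ^ d * hankelDet M d 1) := by
  have hv : (Matrix.of fun i j : Fin (d + 1) => M (0 + i + j)).mulVec
      (fun j : Fin (d + 1) => a j) = Pi.single (Fin.last d) s := by
    ext i
    rw [Matrix.mulVec, dotProduct]
    by_cases hi : i = Fin.last d
    · subst hi
      rw [Pi.single_eq_same, ← h0, Finset.sum_range]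
      refine Finset.sum_congr rfl fun j _ => ?_
      simp [mul_comm]
    · rw [Pi.single_eq_of_ne hi, ← h i (Fin.val_lt_last hi), Finset.sum_range]
      refine Finset.sum_congr rfl fun j _ => ?_
      simp [mul_comm]
  have key := det_mul_eq_of_mulVec_eq_single hv 0
  rw [adjugate_zero_last (M := M)] at key
  · exact key
  · intro i j
    simp only [Matrix.of_apply, Fin.val_castSucc, Fin.val_succ]
    congr 1; ring

/-- The compatibility condition of an overdetermined `(d + 1) × d` Hankel system. -/
lemma hankel_compatible (hd : 1 ≤ d) (h0 : ∑ q ∈ Finset.range d, a q * M q = t)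
    (h : ∀ i, 1 ≤ i → i < d → ∑ q ∈ Finset.range d, a q * M (i + q) = 0)
    (hl : ∑ q ∈ Finset.range d, a q * M (d + q) = s) :
    (-1) ^ d * hankelDet M d 1 * (-t) = s * hankelDet M d 0 := by
  -- The added column is the first unit vector; taken with coefficient `-t`, it cancels the
  -- right-hand side of the first equation.
  set A : Matrix (Fin (d + 1)) (Fin (d + 1)) ℝ := Matrix.of fun i j =>
    if j = Fin.last d then (if i = 0 then 1 else 0) else M (i + j) with hA
  have hdet : A.det = (-1) ^ d * hankelDet M d 1 := by
    have h1 := congrFun (congrFun (Matrix.adjugate_mul A) (Fin.last d)) (Fin.last d)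
    rw [Matrix.mul_apply, Finset.sum_eq_single 0 (fun j _ hj => by simp [hA, hj])
      (fun h => absurd (Finset.mem_univ _) h), adjugate_last_zero (M := M)] at h1
    · simpa [hA] using h1.symm
    · intro i j
      simp only [hA, Matrix.of_apply, if_neg (Fin.castSucc_lt_last j).ne, Fin.val_castSucc,
        Fin.val_succ]
      congr 1; ring
  have hv : A.mulVec (fun j : Fin (d + 1) => if j = Fin.last d then -t else a j)
      = Pi.single (Fin.last d) s := by
    ext i
    rw [Matrix.mulVec, dotProduct, Fin.sum_univ_castSucc]
    have e : ∑ j : Fin d, A i j.castSucc *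
        (if j.castSucc = Fin.last d then -t else a (j.castSucc : Fin (d + 1)))
        = ∑ q ∈ Finset.range d, a q * M (i + q) := by
      rw [Finset.sum_range]
      refine Finset.sum_congr rfl fun j _ => ?_
      simp [hA, (Fin.castSucc_lt_last j).ne, mul_comm]
    rw [e, if_pos rfl]
    by_cases hi0 : i = 0
    · subst hi0
      have : (0 : Fin (d + 1)) ≠ Fin.last d := fun h => by
        have := congrArg Fin.val h; simp at this; omega
      rw [Pi.single_eq_of_ne this]
      simp [hA, h0]
    · have hi1 : 1 ≤ (i : ℕ) := Nat.one_le_iff_ne_zero.2 fun h' => hi0 (Fin.ext h')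
      have hz : A i (Fin.last d) = 0 := by simp [hA, hi0]
      rw [hz, zero_mul, add_zero]
      by_cases hi : i = Fin.last d
      · subst hi
        rw [Pi.single_eq_same, ← hl]
        rfl
      · rw [Pi.single_eq_of_ne hi, h i hi1 (Fin.val_lt_last hi)]
  have key := det_mul_eq_of_mulVec_eq_single hv (Fin.last d)
  rw [hdet, adjugate_last_last (M := M), if_pos rfl] at key
  · exact key
  · intro i j
    simp [hA, (Fin.castSucc_lt_last j).ne]

end Cramer

/-! ### The residue relation. -/

open Polynomial

/-- The residue relation for `F Q + G P = E R`, where `Q / P` is a Stieltjes transform. -/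
lemma sum_residues_eq_neg_coeff {K k : ℕ} {S : SpectralData K} {P Q E F G R : ℝ[X]}
    (hr : S.Represents Q P) (hζ : ∀ j, S.ζ j ≠ 0) (hE : E.Monic) (hEd : E.natDegree = k + 1)
    (hEz : ∀ j, E.eval (S.ζ j) ≠ 0) (hcop : IsCoprime E P)
    (hF : F.natDegree ≤ k) (hG : G.natDegree ≤ k) (h : F * Q + G * P = E * R) :
    ∑ j, S.b j / E.eval (S.ζ j) * F.eval (S.ζ j) + S.c * F.coeff k = -G.coeff k := by
  set t : Fin K → ℝ := fun j => F.eval (S.ζ j) / E.eval (S.ζ j) with ht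
  set D : Fin K → ℝ[X] := fun j => (F - C (t j) * E) /ₘ (X - C (S.ζ j)) with hD
  have hdeg : ∀ j, (F - C (t j) * E).natDegree ≤ k + 1 := fun j =>
    (natDegree_sub_le _ _).trans (max_le (hF.trans k.le_succ)
      ((natDegree_C_mul_le _ _).trans hEd.le))
  have hDd : ∀ j, (D j).natDegree ≤ k := fun j => by
    rw [hD, natDegree_divByMonic _ (monic_X_sub_C _), natDegree_X_sub_C]
    have := hdeg j
    omega
  have hDm : ∀ j, (X - C (S.ζ j)) * D j = F - C (t j) * E := fun j => by
    rw [hD, mul_divByMonic_eq_iff_isRoot, IsRoot, eval_sub, eval_mul, eval_C, ht]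
    simp only
    rw [div_mul_cancel₀ _ (hEz j), sub_self]
  have hDc : ∀ j, (D j).coeff k = -t j := fun j => by
    have h1 := congrArg (fun p => p.coeff (k + 1)) (hDm j)
    simp only [sub_mul, coeff_sub, coeff_X_mul, coeff_C_mul] at h1
    rw [coeff_eq_zero_of_natDegree_lt (p := D j) (Nat.lt_succ_of_le (hDd j)),
      coeff_eq_zero_of_natDegree_lt (p := F) (Nat.lt_succ_of_le hF), ← hEd, hE.coeff_natDegree]
      at h1
    linarith
  -- The sum `∑ b_j D_j` removes the poles at the `ζ_j`, and `H` is `E` times a rational function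
  -- without poles at the zeros of `E`. As `E` is coprime to `P` and has larger degree than `H`, `H
  -- = 0`; its coefficient of degree `k` is the relation.
  set H : ℝ[X] := C S.c * F + G - ∑ j, C (S.b j) * D j with hH
  have hPH : P * H = E * (R - ∑ j, C (S.b j) * C (t j) * rootCofactor S.ζ j) := by
    have e1 : ∀ j, P * (C (S.b j) * D j)
        = -(C (S.b j) * rootCofactor S.ζ j * F) +
          E * (C (S.b j) * C (t j) * rootCofactor S.ζ j) := fun j => by
      have : P = (C (S.ζ j) - X) * rootCofactor S.ζ j := by
        rw [sub_mul_rootCofactor (hζ j), hr.den]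
      rw [this]
      linear_combination (-C (S.b j) * rootCofactor S.ζ j) * hDm j
    rw [hH, mul_sub, Finset.mul_sum, Finset.sum_congr rfl fun j _ => e1 j, Finset.sum_add_distrib,
      Finset.sum_neg_distrib, ← Finset.sum_mul, ← Finset.mul_sum]
    have h2 := hr.num
    linear_combination h - F * h2
  have hH0 : H = 0 := by
    refine eq_zero_of_dvd_of_natDegree_lt
      (hcop.dvd_of_dvd_mul_left (Dvd.intro _ hPH.symm)) ?_
    rw [hEd]
    refine Nat.lt_succ_of_le ((natDegree_sub_le _ _).trans (max_le ((natDegree_add_le _ _).trans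
      (max_le ((natDegree_C_mul_le _ _).trans hF) hG)) ?_))
    exact natDegree_sum_le_of_forall_le _ _ fun j _ => (natDegree_C_mul_le _ _).trans (hDd j)
  have h3 := congrArg (fun p => p.coeff k) hH0
  simp only [hH, coeff_sub, coeff_add, coeff_C_mul, finsetSum_coeff, hDc, coeff_zero] at h3
  have e4 : ∑ j, S.b j / E.eval (S.ζ j) * F.eval (S.ζ j) = -∑ j, S.b j * -t j := by
    rw [← Finset.sum_neg_distrib]
    exact Finset.sum_congr rfl fun j _ => by rw [ht]; ring
  rw [e4]
  linarith

/-- The polynomial `∏_{i ≤ k} (X + e_i)`. -/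
noncomputable def shiftPoly (e : ℕ → ℝ) (k : ℕ) : ℝ[X] := ∏ i ∈ Finset.Icc 1 k, (X + C (e i))

lemma shiftPoly_monic (e : ℕ → ℝ) (k : ℕ) : (shiftPoly e k).Monic :=
  monic_prod_of_monic _ _ fun _ _ => monic_X_add_C _

lemma natDegree_shiftPoly (e : ℕ → ℝ) (k : ℕ) : (shiftPoly e k).natDegree = k := by
  rw [shiftPoly, natDegree_prod_of_monic _ _ fun _ _ => monic_X_add_C _]
  simp

lemma eval_shiftPoly (e : ℕ → ℝ) (k : ℕ) (t : ℝ) :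
    (shiftPoly e k).eval t = ∏ i ∈ Finset.Icc 1 k, (e i + t) := by
  simp [shiftPoly, eval_prod, add_comm]

/-- The zeros `-e_i` are negative and the `ζ_j` positive; for linear factors the Bézout identity is
`(X + e) / ζ + (1 - X / ζ) = e / ζ + 1`. -/
lemma isCoprime_shiftPoly {K k : ℕ} {e : ℕ → ℝ} {ζ : Fin K → ℝ}
    (he : ∀ i ∈ Finset.Icc 1 k, 0 < e i) (hζ : ∀ j, 0 < ζ j) :
    IsCoprime (shiftPoly e k) (rootPoly ζ) := by
  refine IsCoprime.prod_left fun i hi => IsCoprime.prod_right fun j _ => ?_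
  have h1 := he i hi
  have h2 := hζ j
  have h3 : (ζ j)⁻¹ * e i + 1 ≠ 0 := by positivity
  refine ⟨C (((ζ j)⁻¹ * e i + 1)⁻¹ * (ζ j)⁻¹), C (((ζ j)⁻¹ * e i + 1)⁻¹), ?_⟩
  have h4 : (C (((ζ j)⁻¹ * e i + 1)⁻¹) : ℝ[X]) * (C (ζ j)⁻¹ * C (e i) + 1) = 1 := by
    rw [← C_mul, ← C_1, ← C_add, ← C_mul, inv_mul_cancel₀ h3]
  rw [C_mul]
  linear_combination h4

/-- The residue relation in terms of the spectral moments. -/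
lemma sum_coeff_mul_spectralMoment {K N k n i : ℕ} {S : SpectralData K} {P Q F G R : ℝ[X]}
    {e : ℕ → ℝ} (hr : S.Represents Q P) (hS : S.Admissible N)
    (he : ∀ i ∈ Finset.Icc 1 (k + 1), 0 < e i) (hF : ∀ q, n ≤ q → F.coeff q = 0)
    (hin : i + n ≤ k + 1) (hG : ∀ q, k < q → G.coeff q = 0)
    (h : X ^ i * F * Q + G * P = shiftPoly e (k + 1) * R) :
    ∑ q ∈ Finset.range n, F.coeff q * spectralMoment e S (k + 1) (i + q) = -G.coeff k := by
  have hev : ∀ j, (shiftPoly e (k + 1)).eval (S.ζ j) ≠ 0 := fun j => by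
    rw [eval_shiftPoly]
    exact (Finset.prod_pos fun i hi => add_pos (he i hi) (hS.node_pos j)).ne'
  have hFs : F = ∑ q ∈ Finset.range n, C (F.coeff q) * X ^ q := by
    ext r
    simp only [finsetSum_coeff, coeff_C_mul_X_pow, Finset.sum_ite_eq, Finset.mem_range]
    split_ifs with h'
    · rfl
    · exact hF r (not_lt.1 h')
  have hXF : X ^ i * F = ∑ q ∈ Finset.range n, C (F.coeff q) * X ^ (i + q) := by
    nth_rewrite 1 [hFs]
    rw [Finset.mul_sum]
    exact Finset.sum_congr rfl fun q _ => by rw [pow_add]; ring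
  have key := sum_residues_eq_neg_coeff (k := k) hr (fun j => (hS.node_pos j).ne')
    (shiftPoly_monic e (k + 1))
    (natDegree_shiftPoly e (k + 1)) hev (hr.den ▸ isCoprime_shiftPoly he hS.node_pos)
    (F := X ^ i * F) (G := G) (R := R) (by
      rw [natDegree_le_iff_coeff_eq_zero]
      intro r hr'
      rw [coeff_X_pow_mul']
      split_ifs
      · exact hF _ (by omega)
      · rfl) (by
      rw [natDegree_le_iff_coeff_eq_zero]
      exact hG) h
  rw [← key, hXF]
  simp only [eval_finsetSum, eval_mul, eval_C, eval_pow, eval_X, finsetSum_coeff, coeff_C_mul,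
    spectralMoment, coeff_X_pow, eval_shiftPoly, mul_add, Finset.sum_add_distrib, Finset.mul_sum]
  rw [Finset.sum_comm]
  congr 1
  · exact Finset.sum_congr rfl fun j _ => Finset.sum_congr rfl fun q _ => by ring
  · refine Finset.sum_congr rfl fun q _ => ?_
    by_cases hq : k = i + q
    · simp [hq]; ring
    · rw [if_neg hq, if_neg (by omega)]; ring

end

/-! ### Removing the last `k` mass points. -/

section

open Polynomial

/-- The first column `(α, γ / X)` of the product of the adjugates of the last `k` transfer
matrices. -/
noncomputable def backFst (h g : ℕ → ℝ) (N : ℕ) : ℕ → ℝ[X] × ℝ[X]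
  | 0 => (1, 0)
  | k + 1 => ((backFst h g N k).1 - C (h (N - k)) * X * (backFst h g N k).2,
      (backFst h g N k).2 + C (g (N - k)) * (backFst h g N k).1)

/-- The second column `(β, δ)` of the product of the adjugates of the last `k` transfer
matrices. -/
noncomputable def backSnd (h g : ℕ → ℝ) (N : ℕ) : ℕ → ℝ[X] × ℝ[X]
  | 0 => (0, 1)
  | k + 1 => ((backSnd h g N k).1 - C (h (N - k)) * (backSnd h g N k).2,
      (backSnd h g N k).2 + C (g (N - k)) * X * (backSnd h g N k).1)

/-- The determinant of the product of the last `k` transfer matrices. -/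
noncomputable def backDet (h g : ℕ → ℝ) (N k : ℕ) : ℝ[X] :=
  ∏ i ∈ Finset.range k, (1 + C (h (N - i) * g (N - i)) * X)

section

variable {h g : ℕ → ℝ} {N : ℕ}

/-- Each adjugate cancels one transfer matrix and leaves its determinant `1 + h g X`. -/
lemma back_mul_transferPoly {k : ℕ} (hk : k ≤ N) :
    (backFst h g N k).1 * (transferPoly h g N).1 + (backSnd h g N k).1 * (transferPoly h g N).2
        = backDet h g N k * (transferPoly h g (N - k)).1 ∧
    X * (backFst h g N k).2 * (transferPoly h g N).1 +
        (backSnd h g N k).2 * (transferPoly h g N).2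
        = backDet h g N k * (transferPoly h g (N - k)).2 := by
  induction k with
  | zero => simp [backFst, backSnd, backDet]
  | succ k ih =>
    obtain ⟨h1, h2⟩ := ih (by omega)
    obtain ⟨j, hj⟩ : ∃ j, N - k = j + 1 := ⟨N - k - 1, by omega⟩
    have hj' : N - (k + 1) = j := by omega
    have hD : backDet h g N (k + 1) = backDet h g N k * (1 + C (h (j + 1)) * C (g (j + 1)) * X) := by
      rw [backDet, Finset.prod_range_succ, hj, C_mul]; rfl
    rw [hj, transferPoly] at h1 h2
    simp only [backFst, backSnd, hj, hj', hD]
    constructor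
    · linear_combination h1 - C (h (j + 1)) * h2
    · linear_combination h2 + C (g (j + 1)) * X * h1

/-- These degree bounds fix the number of unknowns in the Hankel systems, and the constant term
normalizes them. -/
lemma backFst_coeff (k : ℕ) : (∀ i, k < 2 * i → (backFst h g N k).1.coeff i = 0) ∧
    (∀ i, k ≤ 2 * i → (backFst h g N k).2.coeff i = 0) ∧ (backFst h g N k).1.coeff 0 = 1 := by
  induction k with
  | zero =>
    refine ⟨fun i hi => ?_, fun i _ => by simp [backFst], by simp [backFst]⟩
    rw [backFst, coeff_one, if_neg (by omega)]
  | succ k ih =>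
    obtain ⟨h1, h2, h3⟩ := ih
    refine ⟨fun i hi => ?_, fun i hi => ?_, ?_⟩
    · obtain ⟨i, rfl⟩ : ∃ j, i = j + 1 := ⟨i - 1, by omega⟩
      rw [backFst, coeff_sub, mul_assoc, coeff_C_mul, coeff_X_mul, h1 _ (by omega),
        h2 _ (by omega)]
      simp
    · rw [backFst, coeff_add, coeff_C_mul, h1 _ (by omega), h2 _ (by omega)]
      simp
    · rw [backFst, coeff_sub, mul_assoc, coeff_C_mul, coeff_X_mul_zero, h3]
      simp

lemma backSnd_coeff (k : ℕ) : (∀ i, k ≤ 2 * i → (backSnd h g N k).1.coeff i = 0) ∧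
    (∀ i, k < 2 * i → (backSnd h g N k).2.coeff i = 0) ∧ (backSnd h g N k).2.coeff 0 = 1 := by
  induction k with
  | zero =>
    refine ⟨fun i _ => by simp [backSnd], fun i hi => ?_, by simp [backSnd]⟩
    rw [backSnd, coeff_one, if_neg (by omega)]
  | succ k ih =>
    obtain ⟨h1, h2, h3⟩ := ih
    refine ⟨fun i hi => ?_, fun i hi => ?_, ?_⟩
    · rw [backSnd, coeff_sub, coeff_C_mul, h1 _ (by omega), h2 _ (by omega)]
      simp
    · obtain ⟨i, rfl⟩ : ∃ j, i = j + 1 := ⟨i - 1, by omega⟩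
      rw [backSnd, coeff_add, mul_assoc, coeff_C_mul, coeff_X_mul, h1 _ (by omega),
        h2 _ (by omega)]
      simp
    · rw [backSnd, coeff_add, mul_assoc, coeff_C_mul, coeff_X_mul_zero, h3]
      simp

lemma transferPoly_snd_coeff_zero (j : ℕ) : (transferPoly h g j).2.coeff 0 = 1 := by
  induction j with
  | zero => simp [transferPoly]
  | succ j ih => rw [transferPoly, coeff_sub, mul_assoc, coeff_C_mul, coeff_X_mul_zero, ih]; simp

lemma shiftPoly_eq_C_mul_backDet {e : ℕ → ℝ} {k : ℕ} (he : ∀ i ∈ Finset.Icc 1 k, e i ≠ 0)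
    (heq : ∀ i ∈ Finset.Icc 1 k, h (N + 1 - i) * g (N + 1 - i) = (e i)⁻¹) :
    shiftPoly e k = C (∏ i ∈ Finset.Icc 1 k, e i) * backDet h g N k := by
  rw [shiftPoly, backDet, map_prod, Finset.range_eq_Ico]
  have := Finset.prod_Ico_add' (fun i => (1 + C (h (N + 1 - i) * g (N + 1 - i)) * X : ℝ[X])) 0 k 1
  simp only [Nat.add_sub_add_right] at this
  rw [this, zero_add, show Finset.Ico 1 (k + 1) = Finset.Icc 1 k from rfl,
    ← Finset.prod_mul_distrib]
  refine Finset.prod_congr rfl fun i hi => ?_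
  rw [heq i hi, mul_add, mul_one, ← mul_assoc, ← C_mul, mul_inv_cancel₀ (he i hi), C_1]
  ring

variable {K k : ℕ} {S : SpectralData K} {e : ℕ → ℝ}

/-- The first row relation, multiplied by `X^i`, yields the Hankel equation with index `i`; its
right-hand side vanishes once `k - i` exceeds the degree of `β`. -/
lemma sum_backFst_fst (hr : S.Represents (transferPoly h g N).1 (transferPoly h g N).2)
    (hS : S.Admissible N) (hk : k + 1 ≤ N) (he : ∀ i ∈ Finset.Icc 1 (k + 1), 0 < e i)
    (heq : ∀ i ∈ Finset.Icc 1 (k + 1), h (N + 1 - i) * g (N + 1 - i) = (e i)⁻¹)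
    {i : ℕ} (hi : i + ((k + 1) / 2 + 1) ≤ k + 1) :
    ∑ q ∈ Finset.range ((k + 1) / 2 + 1),
        (backFst h g N (k + 1)).1.coeff q * spectralMoment e S (k + 1) (i + q)
      = -(backSnd h g N (k + 1)).1.coeff (k - i) := by
  have hsh := shiftPoly_eq_C_mul_backDet (N := N) (fun i hi => (he i hi).ne') heq
  have hee : (∏ i ∈ Finset.Icc 1 (k + 1), e i) ≠ 0 := (Finset.prod_pos he).ne'
  have hC : (C (∏ i ∈ Finset.Icc 1 (k + 1), e i) : ℝ[X]) *
      C (∏ i ∈ Finset.Icc 1 (k + 1), e i)⁻¹ = 1 := by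
    rw [← C_mul, mul_inv_cancel₀ hee, C_1]
  rw [sum_coeff_mul_spectralMoment (G := X ^ i * (backSnd h g N (k + 1)).1)
    (R := C (∏ i ∈ Finset.Icc 1 (k + 1), e i)⁻¹ * X ^ i * (transferPoly h g (N - (k + 1))).1)
    hr hS he (fun q hq => (backFst_coeff _).1 q (by omega)) hi]
  · rw [coeff_X_pow_mul', if_pos (by omega)]
  · intro q hq
    rw [coeff_X_pow_mul', if_pos (by omega), (backSnd_coeff _).1 _ (by omega)]
  · rw [hsh]
    linear_combination X ^ i * (back_mul_transferPoly (h := h) (g := g) hk).1 -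
      X ^ i * backDet h g N (k + 1) * (transferPoly h g (N - (k + 1))).1 * hC

/-- Here `F = X · (γ / X)`, so the equations start with the moment index `1`. -/
lemma sum_backFst_snd (hr : S.Represents (transferPoly h g N).1 (transferPoly h g N).2)
    (hS : S.Admissible N) (hk : k + 1 ≤ N) (he : ∀ i ∈ Finset.Icc 1 (k + 1), 0 < e i)
    (heq : ∀ i ∈ Finset.Icc 1 (k + 1), h (N + 1 - i) * g (N + 1 - i) = (e i)⁻¹)
    {i : ℕ} (hi : i + 1 + (k + 2) / 2 ≤ k + 1) :
    ∑ q ∈ Finset.range ((k + 2) / 2),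
        (backFst h g N (k + 1)).2.coeff q * spectralMoment e S (k + 1) (i + 1 + q)
      = -(backSnd h g N (k + 1)).2.coeff (k - i) := by
  have hsh := shiftPoly_eq_C_mul_backDet (N := N) (fun i hi => (he i hi).ne') heq
  have hee : (∏ i ∈ Finset.Icc 1 (k + 1), e i) ≠ 0 := (Finset.prod_pos he).ne'
  have hC : (C (∏ i ∈ Finset.Icc 1 (k + 1), e i) : ℝ[X]) *
      C (∏ i ∈ Finset.Icc 1 (k + 1), e i)⁻¹ = 1 := by
    rw [← C_mul, mul_inv_cancel₀ hee, C_1]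
  rw [sum_coeff_mul_spectralMoment (G := X ^ i * (backSnd h g N (k + 1)).2)
    (R := C (∏ i ∈ Finset.Icc 1 (k + 1), e i)⁻¹ * X ^ i * (transferPoly h g (N - (k + 1))).2)
    hr hS he (fun q hq => (backFst_coeff _).2.1 q (by omega)) hi]
  · rw [coeff_X_pow_mul', if_pos (by omega)]
  · intro q hq
    rw [coeff_X_pow_mul', if_pos (by omega), (backSnd_coeff _).2.1 _ (by omega)]
  · rw [hsh, pow_succ]
    linear_combination X ^ i * (back_mul_transferPoly (h := h) (g := g) hk).2 -
      X ^ i * backDet h g N (k + 1) * (transferPoly h g (N - (k + 1))).2 * hC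

/-- The missing equation with index `0`: subtracting the determinant times `P` from the second row
relation removes the constant terms, so everything can be divided by `X`. The top coefficient of the
determinant then gives the right-hand side. -/
lemma sum_backFst_snd_zero (hr : S.Represents (transferPoly h g N).1 (transferPoly h g N).2)
    (hS : S.Admissible N) (hk : k + 1 ≤ N) (he : ∀ i ∈ Finset.Icc 1 (k + 1), 0 < e i)
    (heq : ∀ i ∈ Finset.Icc 1 (k + 1), h (N + 1 - i) * g (N + 1 - i) = (e i)⁻¹) :
    ∑ q ∈ Finset.range ((k + 2) / 2),
        (backFst h g N (k + 1)).2.coeff q * spectralMoment e S (k + 1) q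
      = (∏ i ∈ Finset.Icc 1 (k + 1), e i)⁻¹ := by
  have hsh := shiftPoly_eq_C_mul_backDet (N := N) (fun i hi => (he i hi).ne') heq
  have hee : (∏ i ∈ Finset.Icc 1 (k + 1), e i) ≠ 0 := (Finset.prod_pos he).ne'
  have hC : (C (∏ i ∈ Finset.Icc 1 (k + 1), e i) : ℝ[X]) *
      C (∏ i ∈ Finset.Icc 1 (k + 1), e i)⁻¹ = 1 := by
    rw [← C_mul, mul_inv_cancel₀ hee, C_1]
  set η := (∏ i ∈ Finset.Icc 1 (k + 1), e i)⁻¹ with hη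
  have hdet : backDet h g N (k + 1) = C η * shiftPoly e (k + 1) := by
    rw [hsh]; linear_combination (-backDet h g N (k + 1)) * hC
  have hdet0 : (backDet h g N (k + 1)).coeff 0 = 1 := by
    rw [coeff_zero_eq_eval_zero, backDet, eval_prod]
    exact Finset.prod_eq_one fun i _ => by simp
  have hdetk : (backDet h g N (k + 1)).coeff (k + 1) = η := by
    have := (shiftPoly_monic e (k + 1)).coeff_natDegree
    rw [natDegree_shiftPoly] at this
    rw [hdet, coeff_C_mul, this, mul_one]
  have hdetd : ∀ q, k + 1 < q → (backDet h g N (k + 1)).coeff q = 0 := fun q hq => by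
    rw [hdet, coeff_C_mul, coeff_eq_zero_of_natDegree_lt (by rwa [natDegree_shiftPoly]), mul_zero]
  have hX1 : X * divX ((backSnd h g N (k + 1)).2 - backDet h g N (k + 1))
      = (backSnd h g N (k + 1)).2 - backDet h g N (k + 1) := by
    have := X_mul_divX_add ((backSnd h g N (k + 1)).2 - backDet h g N (k + 1))
    rwa [coeff_sub, (backSnd_coeff _).2.2, hdet0, sub_self, C_0, add_zero] at this
  have hX2 : X * divX ((transferPoly h g (N - (k + 1))).2 - (transferPoly h g N).2)
      = (transferPoly h g (N - (k + 1))).2 - (transferPoly h g N).2 := by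
    have := X_mul_divX_add ((transferPoly h g (N - (k + 1))).2 - (transferPoly h g N).2)
    rwa [coeff_sub, transferPoly_snd_coeff_zero, transferPoly_snd_coeff_zero, sub_self, C_0,
      add_zero] at this
  have key := sum_coeff_mul_spectralMoment (i := 0) (F := (backFst h g N (k + 1)).2)
    (n := (k + 2) / 2)
    (G := divX ((backSnd h g N (k + 1)).2 - backDet h g N (k + 1)))
    (R := C η * divX ((transferPoly h g (N - (k + 1))).2 - (transferPoly h g N).2))
    hr hS he (fun q hq => (backFst_coeff _).2.1 q (by omega)) (by omega) (fun q hq => by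
      rw [coeff_divX, coeff_sub, (backSnd_coeff _).2.1 _ (by omega), hdetd _ (by omega), sub_self])
    (by
      refine mul_left_cancel₀ (X_ne_zero (R := ℝ)) ?_
      rw [← mul_assoc (shiftPoly e (k + 1)), mul_comm (shiftPoly e (k + 1)), ← hdet]
      linear_combination (transferPoly h g N).2 * hX1 - backDet h g N (k + 1) * hX2 +
        (back_mul_transferPoly (h := h) (g := g) hk).2)
  simp only [zero_add] at key
  rw [key, coeff_divX, coeff_sub, (backSnd_coeff _).2.1 _ (by omega), hdetk]
  ring

/-- The weight `h_{k'}` for even `k` through Hankel determinants. -/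
lemma weight_mul_hankelDet_even {d : ℕ}
    (hr : S.Represents (transferPoly h g N).1 (transferPoly h g N).2)
    (hS : S.Admissible N) (hk : 2 * d + 2 ≤ N) (he : ∀ i ∈ Finset.Icc 1 (2 * d + 2), 0 < e i)
    (heq : ∀ i ∈ Finset.Icc 1 (2 * d + 2), h (N + 1 - i) * g (N + 1 - i) = (e i)⁻¹) :
    h (N - (2 * d + 1)) * (hankelDet (spectralMoment e S (2 * d + 2)) (d + 1) 1 *
        hankelDet (spectralMoment e S (2 * d + 1)) d 1)
      = (∏ i ∈ Finset.Icc 1 (2 * d + 1), e i) *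
        hankelDet (spectralMoment e S (2 * d + 2)) (d + 1) 0 *
        hankelDet (spectralMoment e S (2 * d + 1)) (d + 1) 0 := by
  have hsub : Finset.Icc 1 (2 * d + 1) ⊆ Finset.Icc 1 (2 * d + 2) :=
    Finset.Icc_subset_Icc_right (by omega)
  have hee : (∏ i ∈ Finset.Icc 1 (2 * d + 1), e i) ≠ 0 :=
    (Finset.prod_pos fun i hi => he i (hsub hi)).ne'
  have h1 := hankel_kernel (d := d + 1) (M := spectralMoment e S (2 * d + 2))
    (a := fun q => (backFst h g N (2 * d + 2)).1.coeff q) (fun i hi => by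
      have := sum_backFst_fst (k := 2 * d + 1) (i := i) hr hS hk he heq (by omega)
      rw [(backSnd_coeff _).1 _ (by omega), neg_zero,
        show (2 * d + 1 + 1) / 2 + 1 = d + 1 + 1 by omega] at this
      exact this)
  have h2 := hankel_solve_first (d := d) (M := spectralMoment e S (2 * d + 1))
    (a := fun q => (backFst h g N (2 * d + 1)).2.coeff q)
    (t := (∏ i ∈ Finset.Icc 1 (2 * d + 1), e i)⁻¹) (by
      have := sum_backFst_snd_zero (k := 2 * d) hr hS (by omega) (fun i hi => he i (hsub hi))
        (fun i hi => heq i (hsub hi))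
      rwa [show (2 * d + 2) / 2 = d + 1 by omega] at this) (fun i hi hi' => by
      obtain ⟨i, rfl⟩ : ∃ j, i = j + 1 := ⟨i - 1, by omega⟩
      have := sum_backFst_snd (k := 2 * d) (i := i) hr hS (by omega) (fun i hi => he i (hsub hi))
        (fun i hi => heq i (hsub hi)) (by omega)
      rwa [(backSnd_coeff _).2.1 _ (by omega), neg_zero,
        show (2 * d + 2) / 2 = d + 1 by omega] at this)
  -- In this step the degree of `α` may grow, so its new top coefficient is `-h` times the top one
  -- of `γ / X`.
  have h3 : (backFst h g N (2 * d + 2)).1.coeff (d + 1)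
      = -(h (N - (2 * d + 1)) * (backFst h g N (2 * d + 1)).2.coeff d) := by
    rw [show 2 * d + 2 = (2 * d + 1) + 1 from rfl, backFst, coeff_sub, mul_assoc, coeff_C_mul,
      coeff_X_mul, (backFst_coeff _).1 _ (by omega), zero_sub]
  rw [(backFst_coeff _).2.2, one_mul, h3] at h1
  rw [inv_mul_eq_div, eq_div_iff hee] at h2
  have hs : ((-1 : ℝ) ^ d) * (-1) ^ d = 1 := by rw [← mul_pow]; simp
  rw [← h1, pow_succ]
  linear_combination (-h (N - (2 * d + 1)) *
    hankelDet (spectralMoment e S (2 * d + 2)) (d + 1) 1 * (-1) ^ d) * h2 -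
    h (N - (2 * d + 1)) * hankelDet (spectralMoment e S (2 * d + 2)) (d + 1) 1 *
      hankelDet (spectralMoment e S (2 * d + 1)) d 1 * hs

/-- The weight `h_{k'}` for odd `k` through Hankel determinants. -/
lemma weight_mul_hankelDet_odd {d : ℕ}
    (hr : S.Represents (transferPoly h g N).1 (transferPoly h g N).2)
    (hS : S.Admissible N) (hk : 2 * d + 1 ≤ N) (he : ∀ i ∈ Finset.Icc 1 (2 * d + 1), 0 < e i)
    (heq : ∀ i ∈ Finset.Icc 1 (2 * d + 1), h (N + 1 - i) * g (N + 1 - i) = (e i)⁻¹) :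
    h (N - 2 * d) * (hankelDet (spectralMoment e S (2 * d + 1)) d 1 *
        hankelDet (spectralMoment e S (2 * d)) d 1)
      = (∏ i ∈ Finset.Icc 1 (2 * d), e i) *
        hankelDet (spectralMoment e S (2 * d + 1)) (d + 1) 0 *
        hankelDet (spectralMoment e S (2 * d)) d 0 := by
  have hsub : Finset.Icc 1 (2 * d) ⊆ Finset.Icc 1 (2 * d + 1) :=
    Finset.Icc_subset_Icc_right (by omega)
  have hee : (∏ i ∈ Finset.Icc 1 (2 * d), e i) ≠ 0 :=
    (Finset.prod_pos fun i hi => he i (hsub hi)).ne'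
  have h1 := hankel_solve_last (d := d) (M := spectralMoment e S (2 * d + 1))
    (a := fun q => (backFst h g N (2 * d + 1)).1.coeff q)
    (s := -(backSnd h g N (2 * d + 1)).1.coeff d) (by
      have := sum_backFst_fst (k := 2 * d) (i := d) hr hS hk he heq (by omega)
      rwa [show (2 * d + 1) / 2 + 1 = d + 1 by omega, show 2 * d - d = d by omega] at this)
    (fun i hi => by
      have := sum_backFst_fst (k := 2 * d) (i := i) hr hS hk he heq (by omega)
      rwa [(backSnd_coeff _).1 _ (by omega), neg_zero,
        show (2 * d + 1) / 2 + 1 = d + 1 by omega] at this)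
  -- The top coefficient of `δ` comes from compatibility: `γ / X` has only `d` coefficients but
  -- satisfies `d + 1` equations. For `d = 0` there is no system.
  have h2 : (∏ i ∈ Finset.Icc 1 (2 * d), e i) * (backSnd h g N (2 * d)).2.coeff d *
      hankelDet (spectralMoment e S (2 * d)) d 0
      = (-1) ^ d * hankelDet (spectralMoment e S (2 * d)) d 1 := by
    rcases Nat.eq_zero_or_pos d with rfl | hd
    · simp [hankelDet, backSnd]
    · obtain ⟨k, hk2⟩ : ∃ k, 2 * d = k + 1 := ⟨2 * d - 1, by omega⟩
      have h2 := hankel_compatible (d := d) (M := spectralMoment e S (2 * d))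
        (a := fun q => (backFst h g N (2 * d)).2.coeff q)
        (t := (∏ i ∈ Finset.Icc 1 (2 * d), e i)⁻¹)
        (s := -(backSnd h g N (2 * d)).2.coeff d) hd (by
          rw [hk2] at hsub he heq ⊢
          have := sum_backFst_snd_zero (k := k) hr hS (by omega) (fun i hi => he i (hsub hi))
            (fun i hi => heq i (hsub hi))
          rwa [show (k + 2) / 2 = d by omega] at this) (fun i hi hi' => by
          rw [hk2] at hsub he heq ⊢
          obtain ⟨i, rfl⟩ : ∃ j, i = j + 1 := ⟨i - 1, by omega⟩
          have := sum_backFst_snd (k := k) (i := i) hr hS (by omega) (fun i hi => he i (hsub hi))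
            (fun i hi => heq i (hsub hi)) (by omega)
          rwa [(backSnd_coeff _).2.1 _ (by omega), neg_zero,
            show (k + 2) / 2 = d by omega] at this) (by
          rw [hk2] at hsub he heq ⊢
          have := sum_backFst_snd (k := k) (i := d - 1) hr hS (by omega)
            (fun i hi => he i (hsub hi)) (fun i hi => heq i (hsub hi)) (by omega)
          rwa [show k - (d - 1) = d by omega, show (k + 2) / 2 = d by omega,
            Nat.sub_add_cancel hd] at this)
      rw [mul_neg, ← div_eq_mul_inv, neg_mul, neg_inj, div_eq_iff hee] at h2
      rw [h2]; ring
  have h3 : (backSnd h g N (2 * d + 1)).1.coeff d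
      = -(h (N - 2 * d) * (backSnd h g N (2 * d)).2.coeff d) := by
    rw [backSnd, coeff_sub, coeff_C_mul, (backSnd_coeff _).1 _ (by omega), zero_sub]
  rw [(backFst_coeff _).2.2, mul_one, h3, neg_neg] at h1
  have hs : ((-1 : ℝ) ^ d) * (-1) ^ d = 1 := by rw [← mul_pow]; simp
  rw [h1]
  linear_combination (-h (N - 2 * d) * hankelDet (spectralMoment e S (2 * d + 1)) d 1 *
    (-1) ^ d) * h2 - h (N - 2 * d) * hankelDet (spectralMoment e S (2 * d + 1)) d 1 *
      hankelDet (spectralMoment e S (2 * d)) d 1 * hs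

end

end

/-! ### Position formulas and the theorem. -/

lemma eq_log_of_mul_exp_mul {m x c a b u v : ℝ} (hm : 0 < m) (hu : 0 < u) (hv : 0 < v)
    (h : m * Real.exp x * (u * v) = c * a * b) : x = Real.log (c * a * b / (m * u * v)) := by
  rw [← h, show m * Real.exp x * (u * v) = Real.exp x * (m * u * v) by ring,
    mul_div_cancel_right₀ _ (by positivity), Real.log_exp]

/-- Numerator and denominator each contain one determinant of size `k` and one of size `k - 1`, so a
factor depending only on the size cancels. -/
lemma PositionFormulas.of_mul {N : ℕ} {m x e : ℕ → ℝ} {D D' : ℕ → ℕ → ℕ → ℝ} {w : ℕ → ℝ}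
    (h : PositionFormulas N m x e D) (hw : ∀ k ≤ N, 0 < w k)
    (hD : ∀ k l p, k ≤ N → l ≤ k → p + 2 * l ≤ k + 1 → D' k l p = w k * D k l p) :
    PositionFormulas N m x e D' := by
  have hlog : ∀ c a b μ u v α β : ℝ, 0 < α → 0 < β →
      (c * (α * a) * (β * b)) / (μ * (α * u) * (β * v)) = (c * a * b) / (μ * u * v) := by
    intro c a b μ u v α β hα hβ
    rw [show c * (α * a) * (β * b) = (α * β) * (c * a * b) by ring,
      show μ * (α * u) * (β * v) = (α * β) * (μ * u * v) by ring,
      mul_div_mul_left _ _ (mul_pos hα hβ).ne']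
  intro k hk1 hkN
  have hk := hw k hkN
  have hk' := hw (k - 1) (by omega)
  constructor
  · intro ho
    obtain ⟨d, rfl⟩ := ho
    obtain ⟨h1, h2, h3, h4, h5⟩ := (h _ hk1 hkN).1 ⟨d, rfl⟩
    rw [hD _ _ _ hkN (by omega) (by omega), hD _ _ _ (by omega) (by omega) (by omega),
      hD _ _ _ hkN (by omega) (by omega), hD _ _ _ (by omega) (by omega) (by omega),
      hlog _ _ _ _ _ _ _ _ hk hk']
    exact ⟨mul_pos hk h1, mul_pos hk' h2, mul_pos hk h3, mul_pos hk' h4, h5⟩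
  · intro ho
    obtain ⟨d, rfl⟩ := ho
    obtain ⟨h1, h2, h3, h4, h5⟩ := (h _ hk1 hkN).2 ⟨d, rfl⟩
    rw [hD _ _ _ hkN (by omega) (by omega), hD _ _ _ (by omega) (by omega) (by omega),
      hD _ _ _ hkN (by omega) (by omega), hD _ _ _ (by omega) (by omega) (by omega),
      hlog _ _ _ _ _ _ _ _ hk hk']
    exact ⟨mul_pos hk h1, mul_pos hk' h2, mul_pos hk h3, mul_pos hk' h4, h5⟩

lemma eCoord_pos {N : ℕ} {m n : ℕ → ℝ} (hm : ∀ j ∈ Set.Icc 1 N, 0 < m j)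
    (hn : ∀ j ∈ Set.Icc 1 N, 0 < n j) {i : ℕ} (hi : i ∈ Finset.Icc 1 N) :
    0 < eCoord N m n i := by
  obtain ⟨h1, h2⟩ := Finset.mem_Icc.1 hi
  have hmem : N + 1 - i ∈ Set.Icc 1 N := ⟨by omega, by omega⟩
  exact one_div_pos.2 (mul_pos (hm _ hmem) (hn _ hmem))

lemma hWeight_mul_gWeight (N : ℕ) (m n x : ℕ → ℝ) (i : ℕ) :
    hWeight m x (N + 1 - i) * gWeight n x (N + 1 - i) = (eCoord N m n i)⁻¹ := by
  rw [hWeight, gWeight, eCoord, one_div, inv_inv, Real.exp_neg]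
  have := (Real.exp_pos (x (N + 1 - i))).ne'
  field_simp

lemma positionFormulas_csvReduced {N : ℕ} {m n x : ℕ → ℝ} {S : SpectralData (N / 2)}
    (hm : ∀ j ∈ Set.Icc 1 N, 0 < m j) (hn : ∀ j ∈ Set.Icc 1 N, 0 < n j) (hS : S.Admissible N)
    (hr : S.Represents (transferPoly (hWeight m x) (gWeight n x) N).1
      (transferPoly (hWeight m x) (gWeight n x) N).2) :
    PositionFormulas N m x (eCoord N m n) (csvReduced (eCoord N m n) S) := by
  have he : ∀ k ≤ N, ∀ i ∈ Finset.Icc 1 k, 0 < eCoord N m n i := fun k hk i hi =>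
    eCoord_pos hm hn (Finset.Icc_subset_Icc_right hk hi)
  intro k hk1 hkN
  have hmk := hm (N + 1 - k) ⟨by omega, by omega⟩
  constructor
  · rintro ⟨d, rfl⟩
    rw [show (2 * d + 1 + 1) / 2 = d + 1 by omega, show (2 * d + 1 - 1) / 2 = d by omega,
      Nat.add_sub_cancel]
    have p1 : 0 < csvReduced (eCoord N m n) S (2 * d + 1) (d + 1) 0 := by
      -- The size `d + 1` exceeds the number of nodes only for `k = N` odd; positivity then comes
      -- from `c`.
      rcases Nat.lt_or_ge (N / 2) (d + 1) with h | h
      · exact csvReduced_pos_of_odd ⟨d, by omega⟩ (by omega) (by omega) (he _ hkN) hS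
      · exact csvReduced_pos _ h (he _ hkN) hS
    have p2 : 0 < csvReduced (eCoord N m n) S (2 * d) d 0 :=
      csvReduced_pos _ (by omega) (he _ (by omega)) hS
    have p3 : 0 < csvReduced (eCoord N m n) S (2 * d + 1) d 1 :=
      csvReduced_pos _ (by omega) (he _ hkN) hS
    have p4 : 0 < csvReduced (eCoord N m n) S (2 * d) d 1 :=
      csvReduced_pos _ (by omega) (he _ (by omega)) hS
    refine ⟨p1, p2, p3, p4, eq_log_of_mul_exp_mul hmk p3 p4 ?_⟩
    have key := weight_mul_hankelDet_odd hr hS hkN (he _ hkN) fun i _ =>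
      hWeight_mul_gWeight N m n x i
    rw [← csvReduced_eq_hankelDet _ _ (by omega), ← csvReduced_eq_hankelDet _ _ (by omega),
      ← csvReduced_eq_hankelDet _ _ (by omega), ← csvReduced_eq_hankelDet _ _ (by omega)] at key
    rw [← key, hWeight, show N + 1 - (2 * d + 1) = N - 2 * d by omega]
  · rintro ⟨d, hd⟩
    obtain ⟨d, rfl⟩ : ∃ d', d = d' + 1 := ⟨d - 1, by omega⟩
    obtain rfl : k = 2 * d + 2 := by omega
    rw [show (2 * d + 2) / 2 = d + 1 by omega, show d + 1 - 1 = d by omega,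
      show 2 * d + 2 - 1 = 2 * d + 1 by omega]
    have p1 : 0 < csvReduced (eCoord N m n) S (2 * d + 2) (d + 1) 0 :=
      csvReduced_pos _ (by omega) (he _ hkN) hS
    have p2 : 0 < csvReduced (eCoord N m n) S (2 * d + 1) (d + 1) 0 :=
      csvReduced_pos _ (by omega) (he _ (by omega)) hS
    have p3 : 0 < csvReduced (eCoord N m n) S (2 * d + 2) (d + 1) 1 :=
      csvReduced_pos _ (by omega) (he _ hkN) hS
    have p4 : 0 < csvReduced (eCoord N m n) S (2 * d + 1) d 1 :=
      csvReduced_pos _ (by omega) (he _ (by omega)) hS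
    refine ⟨p1, p2, p3, p4, eq_log_of_mul_exp_mul hmk p3 p4 ?_⟩
    have key := weight_mul_hankelDet_even hr hS hkN (he _ hkN) fun i _ =>
      hWeight_mul_gWeight N m n x i
    rw [← csvReduced_eq_hankelDet _ _ (by omega), ← csvReduced_eq_hankelDet _ _ (by omega),
      ← csvReduced_eq_hankelDet _ _ (by omega), ← csvReduced_eq_hankelDet _ _ (by omega)] at key
    rw [← key, hWeight, show N + 1 - (2 * d + 2) = N - (2 * d + 1) by omega]

lemma vandermondeE_eCoord_ne_zero {N : ℕ} {m n : ℕ → ℝ}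
    (h : Set.InjOn (fun j => m j * n j) (Set.Icc 1 N)) {k : ℕ} (hk : k ≤ N) :
    vandermondeE (eCoord N m n) k ≠ 0 := by
  refine Finset.prod_ne_zero_iff.2 fun i hi => Finset.prod_ne_zero_iff.2 fun j hj h0 => ?_
  obtain ⟨hi1, hi2⟩ := Finset.mem_Icc.1 hi
  obtain ⟨hj1, hj2⟩ := Finset.mem_Ioc.1 hj
  have h1 := h (show N + 1 - j ∈ Set.Icc 1 N from ⟨by omega, by omega⟩)
    (show N + 1 - i ∈ Set.Icc 1 N from ⟨by omega, by omega⟩) (by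
      have := sub_eq_zero.1 h0
      rw [eCoord, eCoord, one_div, one_div, inv_inj] at this
      exact this)
  omega

theorem theorem4p9 (N : ℕ) (m n x : ℕ → ℝ)
    (hm : ∀ j ∈ Set.Icc 1 N, 0 < m j) (hn : ∀ j ∈ Set.Icc 1 N, 0 < n j)
    (hx : StrictMonoOn x (Set.Icc 1 N)) :
    (∃! Φ : ℂ → ℝ → ℂ × ℂ, ∀ z, IsNormalizedSolution N m n x z (Φ z)) ∧
    ∀ Φ : ℂ → ℝ → ℂ × ℂ, (∀ z, IsNormalizedSolution N m n x z (Φ z)) →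
      (∃! S : SpectralData (N / 2), IsSpectralData N m n x Φ S) ∧
      ∀ S : SpectralData (N / 2), IsSpectralData N m n x Φ S →
        (Set.InjOn (fun j => m j * n j) (Set.Icc 1 N) →
          PositionFormulas N m x (eCoord N m n) (csvD (eCoord N m n) S)) ∧
        (∀ k l p : ℕ, k ≤ N → l ≤ k → p + 2 * l ≤ k + 1 →
          csvD (eCoord N m n) S k l p
            = |vandermondeE (eCoord N m n) k| * csvReduced (eCoord N m n) S k l p) ∧
        PositionFormulas N m x (eCoord N m n) (csvReduced (eCoord N m n) S) := by
  have hex := exists_represents (x := x) hm hn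
  refine ⟨⟨fun z => systemSolution N m n x z (0, 1),
    fun z => (isNormalizedSolution_iff hx z _).2 rfl,
    fun Φ hΦ => funext fun z => (isNormalizedSolution_iff hx z _).1 (hΦ z)⟩, fun Φ hΦ => ?_⟩
  have hiff := fun S => isSpectralData_iff_represents hx hΦ S hex
  refine ⟨?_, fun S hSd => ?_⟩
  · obtain ⟨T, hT⟩ := hex
    refine ⟨T, (hiff T).2 hT, fun S hS => ?_⟩
    obtain ⟨h1, h2⟩ := (hiff S).1 hS
    exact h2.unique_of_admissible h1 hT.2 hT.1
  · obtain ⟨hS, hr⟩ := (hiff S).1 hSd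
    have hpos := positionFormulas_csvReduced hm hn hS hr
    have hD : ∀ k l p : ℕ, k ≤ N → l ≤ k → p + 2 * l ≤ k + 1 →
        csvD (eCoord N m n) S k l p
          = |vandermondeE (eCoord N m n) k| * csvReduced (eCoord N m n) S k l p :=
      fun k l p hk hl hp => csvD_eq
        (fun i hi => eCoord_pos hm hn (Finset.Icc_subset_Icc_right hk hi)) hS hl hp
    exact ⟨fun hinj => hpos.of_mul
      (fun k hk => abs_pos.2 (vandermondeE_eCoord_ne_zero hinj hk)) hD, hD, hpos⟩
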